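/- Theorem 1 (Borel--Pompeiu Theorem). Let $n\ge 2$, and let $Cl_n$ be the real Clifford algebra generated by the standard basis $e_1,\dots,e_n$ of $\mathbb{R}^n$ with $e_ie_j+e_je_i=-2\delta_{ij}$; $\mathbb{R}^n$ is regarded as a subspace of $Cl_n$. Every $A\in Cl_n$ has a unique decomposition $A=P(A)+Q(A)e_n$ with $P(A),Q(A)$ in the subalgebra $Cl_{n-1}$ generated by $e_1,\dots,e_{n-1}$; put $Q'(A)=-e_nQ(A)e_n$. On upper half space $\mathbb{R}^{n,+}=\{x\in\mathbb{R}^n: x_n>0\}$ let $$Df=\sum_{j=1}^n e_j\frac{\partial f}{\partial x_j},\qquad Mf=Df+\frac{n-2}{x_n}Q'(f).$$ For $x\ne y$ in $\mathbb{R}^{n,+}$ and $\hat y=(y_1,\dots,y_{n-1},-y_n)$ let $$G(x,y)=\int_{\|x-y\|/\|x-\hat y\|}^{1}\frac{(1-t^2)^{n-2}}{t^{n-1}}\,dt,\qquad p(x,y)=DG(x,y),$$ with $D$ acting in the variable $x$. Let $\omega_n$ be the surface area of the unit sphere in $\mathbb{R}^n$. Let $U$ be a bounded open subset of $\mathbb{R}^{n,+}$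 with (compact) $C^1$ boundary $\partial U$ contained in $\mathbb{R}^{n,+}$, $U$ lying locally on one side of $\partial U$; let $n(x)$ be the outer unit normal at $x\in\partial U$ and $\sigma$ the surface measure on $\partial U$. Let $f:U\to Cl_n$ be a $C^1$ function which extends continuously to $\overline U$ (the extension is again denoted $f$) and for which $Mf$ is integrable on $U$. Then for each $y\in U$ both integrands below are integrable and $$P(f(y))=\frac{1}{2^{n-2}\omega_n}\,P\left(\int_{\partial U}p(x,y)\frac{n(x)}{x_n^{n-2}}f(x)\,d\sigma(x)-\int_{U}p(x,y)\,(Mf(x))\,\frac{dx^n}{x_n^{n-2}}\right).$$ -/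

import Mathlib

open MeasureTheory Set Filter Topology
open scoped InnerProductSpace

namespace UpperHalf

noncomputable section

/-! Throughout, the ambient dimension is `n = k + 2 ≥ 2`, so that `k = n - 2`; the coordinates are
indexed by `Fin (k + 2)` and the distinguished coordinate `x_n` is `x (Fin.last (k + 1))`. -/

/-! ### Euclidean space and upper half space -/

/-- `ℝⁿ` with `n = k + 2`. -/
abbrev E (k : ℕ) : Type := EuclideanSpace ℝ (Fin (k + 2))

/-- The standard orthonormal basis vector `e_j` of `ℝⁿ`. -/
def stdVec {k : ℕ} (j : Fin (k + 2)) : E k := EuclideanSpace.single j (1 : ℝ)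

/-- The last coordinate `x_n`. -/
def lastCoord {k : ℕ} (x : E k) : ℝ := x (Fin.last (k + 1))

/-- Upper half space `{x : x_n > 0}`. -/
def upperHalfSpace (k : ℕ) : Set (E k) := {x | 0 < lastCoord x}

/-- The reflection `x ↦ x̂` changing the sign of the last coordinate. -/
def reflectLast (k : ℕ) : E k →ₗ[ℝ] E k where
  toFun x := x - (2 * lastCoord x) • stdVec (Fin.last (k + 1))
  map_add' x y := by
    have : lastCoord (x + y) = lastCoord x + lastCoord y := rfl
    rw [this]; module
  map_smul' c x := by
    have : lastCoord (c • x) = c * lastCoord x := rfl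
    rw [this]; simp only [RingHom.id_apply]; module

/-! ### The Clifford algebra `Cl_n` of the negative definite form -/

/-- The negative definite quadratic form `x ↦ -‖x‖²` on `ℝⁿ`. -/
def negForm (k : ℕ) : QuadraticForm ℝ (E k) :=
  -(LinearMap.BilinMap.toQuadraticMap (innerₗ (E k)))

theorem negForm_apply {k : ℕ} (x : E k) : negForm k x = -‖x‖ ^ 2 := by
  simp [negForm, LinearMap.BilinMap.toQuadraticMap_apply]

/-- The Clifford algebra `Cl_n`, in which `e_i e_j + e_j e_i = -2 δ_ij`. -/
abbrev Cl (k : ℕ) : Type := CliffordAlgebra (negForm k)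

/-- The embedding of `ℝⁿ` into `Cl_n`. -/
def vec {k : ℕ} (x : E k) : Cl k := CliffordAlgebra.ι (negForm k) x

/-- The generator `e_j` of `Cl_n`. -/
def gen {k : ℕ} (j : Fin (k + 2)) : Cl k := vec (stdVec j)

/-- The last generator `e_n`. -/
def genLast (k : ℕ) : Cl k := gen (Fin.last (k + 1))

/-- The basis `e_A = e_{α₁} ⋯ e_{α_h}`, `A = {α₁ < ⋯ < α_h}`, of `Cl_n`, obtained from the basis
`e_{α₁} ∧ ⋯ ∧ e_{α_h}` of the exterior algebra through the canonical linear isomorphism. -/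
def cliffordBasis (k : ℕ) : Module.Basis (Finset (Fin (k + 2))) ℝ (Cl k) :=
  ((EuclideanSpace.basisFun (Fin (k + 2)) ℝ).toBasis.ExteriorAlgebra).map
    (CliffordAlgebra.equivExterior (negForm k)).symm

/-- The coefficients of an element of `Cl_n` with respect to the basis `e_A`. -/
def coeffs (k : ℕ) : Cl k ≃ₗ[ℝ] EuclideanSpace ℝ (Finset (Fin (k + 2))) :=
  (cliffordBasis k).equivFun.trans (WithLp.linearEquiv 2 ℝ _).symm

/-- `Cl_n` is normed by `‖A‖ = (∑ a_A²)^{1/2}`. -/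
instance instNormedAddCommGroupCl (k : ℕ) : NormedAddCommGroup (Cl k) :=
  NormedAddCommGroup.induced (Cl k) (EuclideanSpace ℝ (Finset (Fin (k + 2)))) (coeffs k)
    (coeffs k).injective

instance instNormedSpaceCl (k : ℕ) : NormedSpace ℝ (Cl k) :=
  NormedSpace.induced ℝ (Cl k) (EuclideanSpace ℝ (Finset (Fin (k + 2)))) (coeffs k)

instance instFiniteDimensionalCl (k : ℕ) : FiniteDimensional ℝ (Cl k) :=
  (cliffordBasis k).finiteDimensional_of_finite

instance instCompleteSpaceCl (k : ℕ) : CompleteSpace (Cl k) := FiniteDimensional.complete ℝ (Cl k)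

/-! ### The projections `P`, `Q` and `Q'` -/

theorem norm_reflectLast {k : ℕ} (x : E k) : ‖reflectLast k x‖ = ‖x‖ := by
  have h : ‖reflectLast k x‖ ^ 2 = ‖x‖ ^ 2 := by
    show ‖x - (2 * lastCoord x) • stdVec (Fin.last (k + 1))‖ ^ 2 = ‖x‖ ^ 2
    rw [norm_sub_sq_real]
    simp [stdVec, lastCoord, inner_smul_right, norm_smul, EuclideanSpace.inner_single_right,
      mul_pow]
    ring
  exact (sq_eq_sq₀ (norm_nonneg _) (norm_nonneg _)).1 h

/-- The algebra automorphism `A ↦ Â` of `Cl_n` with `ê_j = e_j` for `j < n` and `ê_n = -e_n`. -/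
def hat (k : ℕ) : Cl k →ₐ[ℝ] Cl k :=
  CliffordAlgebra.map (Q₁ := negForm k) (Q₂ := negForm k)
    { reflectLast k with
      map_app' := fun x => by
        show negForm k (reflectLast k x) = negForm k x
        rw [negForm_apply, negForm_apply, norm_reflectLast] }

/-- `P : Cl_n → Cl_{n-1}`, `P A = (A + Â) / 2`. -/
def P (k : ℕ) : Cl k →ₗ[ℝ] Cl k := (1 / 2 : ℝ) • (LinearMap.id + (hat k).toLinearMap)

/-- `Q : Cl_n → Cl_{n-1}`, `Q A = -(A - Â) e_n / 2`. -/
def Q (k : ℕ) : Cl k →ₗ[ℝ] Cl k :=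
  (-1 / 2 : ℝ) • (LinearMap.mulRight ℝ (genLast k) ∘ₗ (LinearMap.id - (hat k).toLinearMap))

/-- `Q' A = -e_n (Q A) e_n`. -/
def Q' {k : ℕ} (A : Cl k) : Cl k := -(genLast k * Q k A * genLast k)

/-- The copy of `Cl_{n-1}` inside `Cl_n` generated by `e_1, …, e_{n-1}`. -/
def ClSub (k : ℕ) : Subalgebra ℝ (Cl k) :=
  Algebra.adjoin ℝ (gen '' {j : Fin (k + 2) | j ≠ Fin.last (k + 1)})

theorem lastCoord_stdVec_of_ne {k : ℕ} {j : Fin (k + 2)} (hj : j ≠ Fin.last (k + 1)) :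
    lastCoord (stdVec j) = 0 := by
  simp [lastCoord, stdVec, hj.symm]

theorem hat_vec {k : ℕ} (x : E k) : hat k (vec x) = vec (reflectLast k x) :=
  CliffordAlgebra.map_apply_ι _ _

theorem reflectLast_apply {k : ℕ} (x : E k) :
    reflectLast k x = x - (2 * lastCoord x) • stdVec (Fin.last (k + 1)) := rfl

theorem hat_genLast (k : ℕ) : hat k (genLast k) = -genLast k := by
  have h : reflectLast k (stdVec (Fin.last (k + 1))) = -stdVec (Fin.last (k + 1)) := by
    rw [reflectLast_apply]
    have : lastCoord (stdVec (k := k) (Fin.last (k + 1))) = 1 := by simp [lastCoord, stdVec]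
    rw [this]; module
  rw [genLast, gen, hat_vec, h]
  simp [vec]

theorem genLast_mul_self (k : ℕ) : genLast k * genLast k = -1 := by
  rw [genLast, gen, vec, CliffordAlgebra.ι_sq_scalar, negForm_apply]
  simp [stdVec]

theorem hat_of_mem {k : ℕ} {B : Cl k} (hB : B ∈ ClSub k) : hat k B = B := by
  have h : ClSub k ≤ AlgHom.equalizer (hat k) (AlgHom.id ℝ (Cl k)) := by
    refine Algebra.adjoin_le ?_
    rintro _ ⟨j, hj, rfl⟩
    show hat k (gen j) = gen j
    rw [gen, hat_vec, reflectLast_apply, lastCoord_stdVec_of_ne hj]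
    simp
  exact h hB

/-- `P` picks the first component of the decomposition `Cl_n = Cl_{n-1} + Cl_{n-1} e_n`. -/
theorem P_decomp {k : ℕ} {B C : Cl k} (hB : B ∈ ClSub k) (hC : C ∈ ClSub k) :
    P k (B + C * genLast k) = B := by
  simp only [P, LinearMap.smul_apply, LinearMap.add_apply, LinearMap.id_apply,
    AlgHom.toLinearMap_apply, map_add, map_mul, hat_of_mem hB, hat_of_mem hC, hat_genLast, mul_neg]
  module

/-- `Q` picks the second component of the decomposition `Cl_n = Cl_{n-1} + Cl_{n-1} e_n`. -/
theorem Q_decomp {k : ℕ} {B C : Cl k} (hB : B ∈ ClSub k) (hC : C ∈ ClSub k) :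
    Q k (B + C * genLast k) = C := by
  have hh : hat k (B + C * genLast k) = B + -(C * genLast k) := by
    rw [map_add, map_mul, hat_of_mem hB, hat_of_mem hC, hat_genLast, mul_neg]
  show (-1 / 2 : ℝ) • ((B + C * genLast k - hat k (B + C * genLast k)) * genLast k) = C
  rw [hh]
  have h : (B + C * genLast k - (B + -(C * genLast k))) * genLast k = (-2 : ℝ) • C := by
    have : B + C * genLast k - (B + -(C * genLast k)) = (2 : ℝ) • (C * genLast k) := by module
    rw [this, smul_mul_assoc, mul_assoc, genLast_mul_self]
    simp
  rw [h]; module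

/-- Every element of `Cl_n` decomposes as `B + C e_n` with `B, C ∈ Cl_{n-1}`. -/
theorem exists_decomp {k : ℕ} (A : Cl k) :
    ∃ B ∈ ClSub k, ∃ C ∈ ClSub k, A = B + C * genLast k := by
  induction A using CliffordAlgebra.right_induction with
  | algebraMap r => exact ⟨_, (ClSub k).algebraMap_mem r, 0, (ClSub k).zero_mem, by simp⟩
  | add x y hx hy =>
    obtain ⟨B, hB, C, hC, rfl⟩ := hx
    obtain ⟨B', hB', C', hC', rfl⟩ := hy
    exact ⟨B + B', (ClSub k).add_mem hB hB', C + C', (ClSub k).add_mem hC hC', by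
      rw [add_mul]; abel⟩
  | mul_ι m x h =>
    obtain ⟨B, hB, C, hC, rfl⟩ := h
    set u : E k := m - (lastCoord m) • stdVec (Fin.last (k + 1)) with hu
    have hm : CliffordAlgebra.ι (negForm k) m = vec u + (lastCoord m) • genLast k := by
      have : m = u + (lastCoord m) • stdVec (Fin.last (k + 1)) := by rw [hu]; module
      conv_lhs => rw [this]
      rw [map_add, map_smul]; rfl
    have hlast : lastCoord u = 0 := by simp [hu, lastCoord, stdVec]
    have huS : vec u ∈ ClSub k := by
      have hsum : u = ∑ j, u j • stdVec j := by
        ext i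
        simp [stdVec, Finset.sum_apply, Pi.single_apply]
      rw [hsum, vec, map_sum]
      refine (ClSub k).sum_mem fun j _ => ?_
      rw [map_smul]
      by_cases hj : j = Fin.last (k + 1)
      · have : u j = 0 := by rw [hj]; exact hlast
        rw [this, zero_smul]; exact (ClSub k).zero_mem
      · exact (ClSub k).smul_mem (Algebra.subset_adjoin ⟨j, hj, rfl⟩) _
    have hanti : genLast k * vec u = -(vec u * genLast k) := by
      have h0 : (negForm k).IsOrtho (stdVec (Fin.last (k + 1))) u := by
        have hi : ⟪stdVec (Fin.last (k + 1)), u⟫_ℝ = 0 := by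
          rw [stdVec, EuclideanSpace.inner_single_left]
          have : u (Fin.last (k + 1)) = 0 := hlast
          simp [this]
        rw [QuadraticMap.isOrtho_def, negForm_apply, negForm_apply, negForm_apply,
          norm_add_sq_real, hi]
        ring
      exact CliffordAlgebra.ι_mul_ι_comm_of_isOrtho h0
    refine ⟨B * vec u - (lastCoord m) • C, (ClSub k).sub_mem ((ClSub k).mul_mem hB huS)
      ((ClSub k).smul_mem hC _), (lastCoord m) • B - C * vec u,
      (ClSub k).sub_mem ((ClSub k).smul_mem hB _) ((ClSub k).mul_mem hC huS), ?_⟩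
    rw [hm, add_mul, mul_add, mul_add, mul_assoc C, mul_assoc C, hanti, mul_smul_comm,
      mul_smul_comm, genLast_mul_self, sub_mul, smul_mul_assoc, mul_neg, mul_assoc C, smul_neg,
      mul_neg, mul_smul_comm, mul_one]
    abel

/-! ### The Dirac and Dirac-Hodge operators and the hypermonogenic kernel -/

/-- The Euclidean Dirac operator `D f = ∑ e_j ∂f/∂x_j`. -/
def dirac {k : ℕ} (f : E k → Cl k) (x : E k) : Cl k :=
  ∑ j : Fin (k + 2), gen j * fderiv ℝ f x (stdVec j)

/-- The Dirac-Hodge operator `M f = D f + ((n - 2) / x_n) Q'(f)`. -/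
def diracHodge {k : ℕ} (f : E k → Cl k) (x : E k) : Cl k :=
  dirac f x + ((k : ℝ) / lastCoord x) • Q' (f x)

/-- The hyperbolic Green function
`G(x, y) = ∫_{‖x - y‖ / ‖x - ŷ‖}^1 (1 - t²)^{n-2} / t^{n-1} dt`. -/
def green {k : ℕ} (x y : E k) : ℝ :=
  ∫ t in (‖x - y‖ / ‖x - reflectLast k y‖)..1, (1 - t ^ 2) ^ k / t ^ (k + 1)

/-- The hypermonogenic kernel `p(x, y) = D G(x, y)`, with `D` acting in the variable `x`. -/
def kernelP {k : ℕ} (x y : E k) : Cl k :=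
  dirac (fun z => algebraMap ℝ (Cl k) (green z y)) x

/-- The surface area `ω_n` of the unit sphere of `ℝⁿ`. -/
def sphereArea (k : ℕ) : ℝ := (volume : Measure (E k)).toSphere.real Set.univ

/-! ### Open sets with `C¹` boundary -/

/-- `φ` is a `C¹` defining function of `U` near the boundary point `x`: near `x`, the set `U` is
`{φ < 0}`, and `∇φ(x) ≠ 0`. -/
structure IsLocalDefiningFunction {k : ℕ} (U : Set (E k)) (x : E k) (φ : E k → ℝ) : Prop where
  contDiffAt : ContDiffAt ℝ 1 φ x
  apply_eq_zero : φ x = 0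
  gradient_ne_zero : gradient φ x ≠ 0
  mem_iff : ∀ᶠ z in 𝓝 x, z ∈ U ↔ φ z < 0

/-- `U` has `C¹` boundary (and lies locally on one side of it). -/
def HasC1Boundary {k : ℕ} (U : Set (E k)) : Prop :=
  ∀ x ∈ frontier U, ∃ φ : E k → ℝ, IsLocalDefiningFunction U x φ

open Classical in
/-- The outer unit normal of `U` at `x`: the normalized gradient of a local defining function. -/
def outerNormal {k : ℕ} (U : Set (E k)) (x : E k) : E k :=
  if h : ∃ φ : E k → ℝ, IsLocalDefiningFunction U x φ then
    ‖gradient h.choose x‖⁻¹ • gradient h.choose x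
  else 0

theorem IsLocalDefiningFunction.inner_nonpos {k : ℕ} {U : Set (E k)} {x : E k} {φ ψ : E k → ℝ}
    (hφ : IsLocalDefiningFunction U x φ) (hψ : IsLocalDefiningFunction U x ψ) {v : E k}
    (hv : ⟪gradient φ x, v⟫_ℝ < 0) : ⟪gradient ψ x, v⟫_ℝ ≤ 0 := by
  have line : ∀ χ : E k → ℝ, IsLocalDefiningFunction U x χ →
      HasDerivAt (fun t : ℝ => χ (x + t • v)) ⟪gradient χ x, v⟫_ℝ 0 := by
    intro χ hχ
    have h1 : HasGradientAt χ (gradient χ x) (x + (0 : ℝ) • v) := by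
      simpa using (hχ.contDiffAt.differentiableAt (by simp)).hasGradientAt
    have h2 : HasDerivAt (fun t : ℝ => x + t • v) v 0 := by
      simpa using ((hasDerivAt_id (0 : ℝ)).smul_const v).const_add x
    have h3 := h1.hasFDerivAt.comp_hasDerivAt (0 : ℝ) h2
    exact h3
  have hcont : Tendsto (fun t : ℝ => x + t • v) (𝓝[>] 0) (𝓝 x) := by
    have : Continuous fun t : ℝ => x + t • v := by fun_prop
    simpa using (this.tendsto 0).mono_left nhdsWithin_le_nhds
  have hle : 𝓝[>] (0 : ℝ) ≤ 𝓝[≠] 0 := nhdsWithin_mono _ fun t (ht : 0 < t) => ht.ne'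
  have s1 := (hasDerivAt_iff_tendsto_slope.1 (line φ hφ)).mono_left hle
  have s2 := (hasDerivAt_iff_tendsto_slope.1 (line ψ hψ)).mono_left hle
  refine le_of_tendsto s2 ?_
  filter_upwards [s1.eventually (gt_mem_nhds hv), hcont.eventually hφ.mem_iff,
    hcont.eventually hψ.mem_iff, self_mem_nhdsWithin] with t h1 h2 h3 (ht : 0 < t)
  rw [slope_def_field] at h1 ⊢
  simp only [zero_smul, add_zero, sub_zero, hφ.apply_eq_zero, hψ.apply_eq_zero] at h1 ⊢
  have h4 : φ (x + t • v) < 0 := by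
    have := (div_lt_iff₀ ht).1 h1
    simpa using this
  exact div_nonpos_of_nonpos_of_nonneg (h3.1 (h2.2 h4)).le ht.le

/-- The outer unit normal does not depend on the choice of the defining function. -/
theorem IsLocalDefiningFunction.outerNormal_eq {k : ℕ} {U : Set (E k)} {x : E k} {φ : E k → ℝ}
    (hφ : IsLocalDefiningFunction U x φ) :
    outerNormal U x = ‖gradient φ x‖⁻¹ • gradient φ x := by
  have h : ∃ φ : E k → ℝ, IsLocalDefiningFunction U x φ := ⟨φ, hφ⟩
  rw [outerNormal, dif_pos h]
  have hψ := h.choose_spec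
  set ψ := h.choose
  have key := fun v => hφ.inner_nonpos hψ (v := v)
  have a0 := norm_pos_iff.2 hφ.gradient_ne_zero
  have b0 := norm_pos_iff.2 hψ.gradient_ne_zero
  set a := gradient φ x
  set b := gradient ψ x
  -- test with `v = ‖a‖ b - ‖b‖ a`, using Cauchy-Schwarz for strictness
  have hcs : ⟪a, b⟫_ℝ = ‖a‖ * ‖b‖ := by
    by_contra hne
    have hlt : ⟪a, b⟫_ℝ < ‖a‖ * ‖b‖ := lt_of_le_of_ne (real_inner_le_norm a b) hne
    have h1 : ⟪a, ‖a‖ • b - ‖b‖ • a⟫_ℝ < 0 := by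
      rw [inner_sub_right, real_inner_smul_right, real_inner_smul_right,
        real_inner_self_eq_norm_sq]
      nlinarith [mul_pos a0 (sub_pos.2 hlt)]
    have h2 := key _ h1
    rw [inner_sub_right, real_inner_smul_right, real_inner_smul_right,
      real_inner_self_eq_norm_sq, real_inner_comm] at h2
    nlinarith [mul_pos b0 (sub_pos.2 hlt)]
  have := inner_eq_norm_mul_iff_real.1 hcs
  rw [inv_smul_eq_iff₀ b0.ne', smul_smul, mul_comm, ← smul_smul, this.symm.symm,
    eq_inv_smul_iff₀ a0.ne']

end

end UpperHalf

open UpperHalf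

/-! Write `a = x - y`, `b = x - ŷ`, `k = n - 2`, and let `K z = z / ‖z‖ⁿ` be the Cauchy kernel.
Since `‖b‖² - ‖a‖² = 4 x_n y_n`, differentiating the Green function gives `p(x, y) = x_n^k γ(x)`
with `γ = -(4 y_n)^k (‖b‖^{-k} K a - ‖a‖^{-k} K b)` (`hasFDerivAt_green`, `kernelP_eq`). The weight
`x_n^{-k}` therefore cancels, and the formula concerns the flux of `u ↦ P(γ u f)`.

The divergence of this field is `P((γD) f + γ Df)`, with `D` acting on `γ` from the right in the
first term. `K` is right monogenic and `∇‖z‖^{-k} = -k K z`, so only a multiple of the commutator of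
`K a` and `K b` survives in `γD`. As `b = a + 2 y_n e_n`, that commutator is a multiple of `a' e_n`,
the prime denoting the component orthogonal to `e_n`, and in fact `γD = -(k / x_n) γ' e_n`
(`sum_vec_fderiv_hypField_mul_gen`). Finally `P(γ' e_n A) = -P(γ Q'A)` (`P_horizontal_mul`), so the
divergence equals `P(γ Mf)` (`divergence_fieldL`). This last exchange holds only after applying `P`,
which explains the `P` in the theorem.

Near `y` the field `γ` behaves like `-2^k K(x - y)`. Instead of removing a ball, the field is
multiplied by a smooth radial function vanishing near `y`, the divergence theorem is applied on `U`
itself, and the radius tends to `0`. After rescaling, the gradient of the cutoff contributes a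
radial integral with value `-2^k ω_n P(f y)` (`tendsto_integral_fieldL_cutoffGrad`).

The divergence theorem needed here (`setIntegral_divergence`) allows fields that are `C¹` only
inside, continuous up to the boundary, and of integrable divergence. It is obtained by localizing to
regions below `C¹` graphs, straightening these by a shear, and exhausting the half space by smaller
ones. The area formula `comap_euclideanHausdorffMeasure` identifies the Hausdorff measure on a
graph. -/

namespace UpperHalf

/-! ### Hausdorff measure of `C¹` images: the area formula. -/

open Module Measure in
-- The distance hypothesis forces `f` to factor on `s` through `g` by a `K`-Lipschitz map, even if
-- neither map is injective; such a map enlarges `d`-dimensional Hausdorff measure by at most `K ^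
-- d`.
theorem euclideanHausdorffMeasure_image_le_of_edist_le {α X Y : Type*} [Nonempty α]
    [EMetricSpace X] [MeasurableSpace X] [BorelSpace X]
    [EMetricSpace Y] [MeasurableSpace Y] [BorelSpace Y]
    (f : α → X) (g : α → Y) (s : Set α) (K : NNReal) (d : ℕ)
    (h : ∀ x ∈ s, ∀ y ∈ s, edist (f x) (f y) ≤ K * edist (g x) (g y)) :
    μHE[d] (f '' s) ≤ (K : ENNReal) ^ d * μHE[d] (g '' s) := by
  set φ : Y → X := f ∘ Function.invFunOn g s with hφ
  have hinv : ∀ x ∈ s, Function.invFunOn g s (g x) ∈ s ∧ g (Function.invFunOn g s (g x)) = g x :=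
    fun x hx => ⟨Function.invFunOn_mem ⟨x, hx, rfl⟩, Function.invFunOn_eq ⟨x, hx, rfl⟩⟩
  have himg : f '' s = φ '' (g '' s) := by
    rw [image_image]
    refine image_congr fun x hx => ?_
    have := h x hx _ (hinv x hx).1
    rw [(hinv x hx).2, edist_self, mul_zero] at this
    exact edist_le_zero.1 this
  have hL : LipschitzOnWith K φ (g '' s) := by
    rintro _ ⟨x, hx, rfl⟩ _ ⟨y, hy, rfl⟩
    have := h _ (hinv x hx).1 _ (hinv y hy).1
    rwa [(hinv x hx).2, (hinv y hy).2] at this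
  have := hL.hausdorffMeasure_image_le (d := d) (by positivity)
  rw [himg, euclideanHausdorffMeasure_def, euclideanHausdorffMeasure_def,
    Measure.smul_apply, Measure.smul_apply, ENNReal.smul_def, ENNReal.smul_def, smul_eq_mul,
    smul_eq_mul, mul_left_comm]
  gcongr
  simpa using this

section Area

open Module Measure

variable {W E : Type*} [NormedAddCommGroup W] [InnerProductSpace ℝ W] [FiniteDimensional ℝ W]
  [MeasurableSpace W] [BorelSpace W] [NormedAddCommGroup E] [InnerProductSpace ℝ E]
  [MeasurableSpace E] [BorelSpace E]

/-- Near `w`, strict differentiability makes the distances `‖Φ x - Φ y‖` and `‖A (x - y)‖`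
comparable with factor `K` both ways. The measure of the linear image is known exactly. -/
theorem euclideanHausdorffMeasure_image_near {Φ : W → E} {A : W →L[ℝ] E} {w : W}
    (hΦ : HasStrictFDerivAt Φ A w) (hA : Function.Injective A) {K : NNReal} (hK : 1 < K) :
    ∃ N ∈ 𝓝 w, ∀ s ⊆ N,
      μHE[finrank ℝ W] (Φ '' s) ≤
        (K : ENNReal) ^ finrank ℝ W * (ENNReal.ofReal A.toLinearMap.normDet * volume s) ∧
      ENNReal.ofReal A.toLinearMap.normDet * volume s ≤
        (K : ENNReal) ^ finrank ℝ W * μHE[finrank ℝ W] (Φ '' s) := by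
  obtain ⟨C, hC, hanti⟩ := (LinearMap.injective_iff_antilipschitz A.toLinearMap).1 hA
  have hC' : (0 : ℝ) < C := hC
  have hK' : (1 : ℝ) < K := hK
  -- This relative error serves both directions: `1 - t = K⁻¹`, while `1 + t ≤ K` because `K + K⁻¹ ≥
  -- 2`.
  set t : ℝ := 1 - (K : ℝ)⁻¹ with ht
  have hKi : (K : ℝ)⁻¹ < 1 := inv_lt_one_of_one_lt₀ hK'
  have ht0 : 0 < t := by linarith
  have hKK : (K : ℝ)⁻¹ * K = 1 := inv_mul_cancel₀ (by positivity)
  have htK : 1 + t ≤ K := by nlinarith [mul_pos ht0 (sub_pos.2 hK')]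
  -- Dividing by the antilipschitz constant of `A` converts an error relative to `‖x - y‖` into one
  -- relative to `‖A (x - y)‖`.
  obtain ⟨N, hN, hap⟩ := hΦ.approximates_deriv_on_nhds (c := (t / C).toNNReal)
    (Or.inr (by simpa using div_pos ht0 hC'))
  have hdist : ∀ x ∈ N, ∀ y ∈ N, ‖Φ x - Φ y - A (x - y)‖ ≤ t * ‖A (x - y)‖ := by
    intro x hx y hy
    have h1 := hap x hx y hy
    have h2 : ‖x - y‖ ≤ C * ‖A (x - y)‖ := by
      have := hanti.le_mul_dist x y
      simpa [dist_eq_norm, ← map_sub] using this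
    rw [Real.coe_toNNReal _ (div_pos ht0 hC').le] at h1
    calc _ ≤ t / C * ‖x - y‖ := h1
      _ ≤ t / C * (C * ‖A (x - y)‖) := by gcongr
      _ = t * ‖A (x - y)‖ := by field_simp
  have e1 : ∀ x ∈ N, ∀ y ∈ N, ‖Φ x - Φ y‖ ≤ K * ‖A (x - y)‖ := by
    intro x hx y hy
    have h1 := hdist x hx y hy
    have h2 := norm_le_norm_add_norm_sub (A (x - y)) (Φ x - Φ y)
    rw [norm_sub_rev (A (x - y))] at h2
    nlinarith [norm_nonneg (A (x - y))]
  have e2 : ∀ x ∈ N, ∀ y ∈ N, ‖A (x - y)‖ ≤ K * ‖Φ x - Φ y‖ := by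
    intro x hx y hy
    have h1 := hdist x hx y hy
    have h2 := norm_le_norm_add_norm_sub (Φ x - Φ y) (A (x - y))
    have h3 : (K : ℝ)⁻¹ * ‖A (x - y)‖ ≤ ‖Φ x - Φ y‖ := by
      rw [ht] at h1; linarith
    calc ‖A (x - y)‖ = K * ((K : ℝ)⁻¹ * ‖A (x - y)‖) := by
          rw [← mul_assoc, mul_comm (K : ℝ), hKK, one_mul]
      _ ≤ _ := by gcongr
  refine ⟨N, hN, fun s hs => ?_⟩
  rw [← LinearMap.euclideanHausdorffMeasure_image_eq_normDet_mul_volume]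
  constructor
  · refine euclideanHausdorffMeasure_image_le_of_edist_le Φ A.toLinearMap s K _ fun x hx y hy => ?_
    have := e1 x (hs hx) y (hs hy)
    rw [edist_nndist, edist_nndist, ← ENNReal.coe_mul, ENNReal.coe_le_coe, ← NNReal.coe_le_coe]
    simpa [dist_eq_norm] using this
  · refine euclideanHausdorffMeasure_image_le_of_edist_le A.toLinearMap Φ s K _ fun x hx y hy => ?_
    have := e2 x (hs hx) y (hs hy)
    rw [edist_nndist, edist_nndist, ← ENNReal.coe_mul, ENNReal.coe_le_coe, ← NNReal.coe_le_coe]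
    simpa [dist_eq_norm] using this

theorem ennreal_le_of_forall_le_pow_mul {a b : ENNReal} (d : ℕ)
    (h : ∀ K : NNReal, 1 < K → a ≤ (K : ENNReal) ^ d * b) : a ≤ b := by
  by_cases hb : b = ⊤
  · simp [hb]
  have ht : Tendsto (fun K : NNReal => (K : ENNReal) ^ d * b) (𝓝[>] 1) (𝓝 (((1 : NNReal) : ENNReal) ^ d * b)) := by
    refine Tendsto.mono_left ?_ nhdsWithin_le_nhds
    have : Continuous fun K : NNReal => (K : ENNReal) ^ d * b := by
      have h1 : Continuous fun K : NNReal => (K : ENNReal) ^ d :=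
        (ENNReal.continuous_pow d).comp ENNReal.continuous_coe
      exact (ENNReal.continuous_mul_const hb).comp h1
    exact this.tendsto 1
  have hne : (𝓝[>] (1 : NNReal)).NeBot := inferInstance
  have := ge_of_tendsto ht (eventually_nhdsWithin_of_forall fun K hK => h K hK)
  simpa using this

/-- The area formula for an injective `C¹` immersion. -/
theorem comap_euclideanHausdorffMeasure {Φ : W → E} (hΦ : ContDiff ℝ 1 Φ)
    (hinj : Function.Injective Φ) (himm : ∀ w, Function.Injective (fderiv ℝ Φ w)) :
    Measure.comap Φ μHE[finrank ℝ W] =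
      (volume : Measure W).withDensity
        fun w => ENNReal.ofReal (fderiv ℝ Φ w).toLinearMap.normDet := by
  have hemb : MeasurableEmbedding Φ := hΦ.continuous.measurableEmbedding hinj
  have hnear := fun w K (hK : (1 : NNReal) < K) => euclideanHausdorffMeasure_image_near
    (hΦ.contDiffAt.hasStrictFDerivAt (x := w) one_ne_zero) (himm w) hK
  set m := Measure.comap Φ μHE[finrank ℝ W] with hm
  have hmap : ∀ s, m s = μHE[finrank ℝ W] (Φ '' s) := fun s => hemb.comap_apply _ s
  simp only [← hmap] at hnear
  have : IsLocallyFiniteMeasure m := by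
    refine ⟨fun w => ?_⟩
    obtain ⟨N, hN, hs⟩ := hnear w 2 (by norm_num)
    obtain ⟨r, hr, hrN⟩ := Metric.nhds_basis_closedBall.mem_iff.1 hN
    refine ⟨Metric.closedBall w r, Metric.closedBall_mem_nhds w hr, (hs _ hrN).1.trans_lt ?_⟩
    exact ENNReal.mul_lt_top (ENNReal.pow_lt_top ENNReal.coe_lt_top)
      (ENNReal.mul_lt_top ENNReal.ofReal_lt_top measure_closedBall_lt_top)
  have hac : m ≪ volume := by
    intro s hs
    refine measure_null_of_locally_null s fun w _ => ?_
    obtain ⟨N, hN, h⟩ := hnear w 2 (by norm_num)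
    refine ⟨N ∩ s, Filter.inter_mem (mem_nhdsWithin_of_mem_nhds hN) self_mem_nhdsWithin, ?_⟩
    have h1 := (h _ (inter_subset_left : N ∩ s ⊆ N)).1
    rw [measure_mono_null inter_subset_right hs] at h1
    simpa using h1
  rw [← withDensity_rnDeriv_eq m volume hac]
  refine withDensity_congr_ae ?_
  -- The density is almost everywhere the limit of ratios over shrinking balls. The local estimate
  -- traps these ratios between `K^{-d}` and `K^d` times the Jacobian, for every `K > 1`.
  filter_upwards [Besicovitch.ae_tendsto_rnDeriv m (volume : Measure W)] with w hw
  have hball : ∀ᶠ r : ℝ in 𝓝[>] 0, 0 < r := self_mem_nhdsWithin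
  have hsmall : ∀ N ∈ 𝓝 w, ∀ᶠ r : ℝ in 𝓝[>] 0, Metric.closedBall w r ⊆ N := by
    intro N hN
    obtain ⟨r, hr, hrN⟩ := Metric.nhds_basis_closedBall.mem_iff.1 hN
    filter_upwards [Ioc_mem_nhdsGT hr] with r' hr'
    exact (Metric.closedBall_subset_closedBall hr'.2).trans hrN
  have hv : ∀ r : ℝ, 0 < r → volume (Metric.closedBall w r) ≠ 0 :=
    fun r hr => (Metric.measure_closedBall_pos volume w hr).ne'
  have hv' : ∀ r : ℝ, volume (Metric.closedBall w r) ≠ ⊤ := fun r => measure_closedBall_lt_top.ne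
  apply le_antisymm
  · refine ennreal_le_of_forall_le_pow_mul (finrank ℝ W) fun K hK => ?_
    obtain ⟨N, hN, h⟩ := hnear w K hK
    refine le_of_tendsto hw ?_
    filter_upwards [hsmall N hN, hball] with r hr hr0
    refine ENNReal.div_le_of_le_mul ?_
    rw [mul_assoc]
    exact (h _ hr).1
  · refine ennreal_le_of_forall_le_pow_mul (finrank ℝ W) fun K hK => ?_
    obtain ⟨N, hN, h⟩ := hnear w K hK
    have hlim := ENNReal.Tendsto.const_mul (a := (K : ENNReal) ^ finrank ℝ W) hw
      (Or.inr (ENNReal.pow_ne_top ENNReal.coe_ne_top))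
    refine ge_of_tendsto hlim ?_
    filter_upwards [hsmall N hN, hball] with r hr hr0
    rw [← mul_div_assoc, ENNReal.le_div_iff_mul_le (Or.inl (hv r hr0)) (Or.inl (hv' r))]
    exact (h _ hr).2

theorem restrict_range_euclideanHausdorffMeasure {Φ : W → E} (hΦ : ContDiff ℝ 1 Φ)
    (hinj : Function.Injective Φ) (himm : ∀ w, Function.Injective (fderiv ℝ Φ w)) :
    μHE[finrank ℝ W].restrict (range Φ) =
      ((volume : Measure W).withDensity
        fun w => ENNReal.ofReal (fderiv ℝ Φ w).toLinearMap.normDet).map Φ := by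
  rw [← comap_euclideanHausdorffMeasure hΦ hinj himm]
  exact ((hΦ.continuous.measurableEmbedding hinj).map_comap _).symm

end Area

/-- The Jacobian of the graph map of a linear form. -/
theorem normDet_graph {W E : Type*} [NormedAddCommGroup W] [InnerProductSpace ℝ W]
    [FiniteDimensional ℝ W] [NormedAddCommGroup E] [InnerProductSpace ℝ E] [FiniteDimensional ℝ E]
    {A : W →ₗ[ℝ] E} {p : W} (hA : ∀ u v, ⟪A u, A v⟫_ℝ = ⟪u, v⟫_ℝ + ⟪p, u⟫_ℝ * ⟪p, v⟫_ℝ) :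
    A.normDet = √(1 + ‖p‖ ^ 2) := by
  -- The Gram operator is the identity plus the rank-one map `⟪p, ·⟫ p`, whose determinant `1 +
  -- ‖p‖²` is that of a transvection.
  have h1 : LinearMap.adjoint A ∘ₗ A = LinearMap.transvection (innerₗ W p) p := by
    ext u
    refine ext_inner_right ℝ fun v => ?_
    rw [LinearMap.comp_apply, LinearMap.adjoint_inner_left, hA, LinearMap.transvection.apply,
      inner_add_left, inner_smul_left]
    simp
  have h2 := A.normDet_sq
  rw [h1, LinearMap.transvection.det] at h2
  simp only [innerₗ_apply_apply, real_inner_self_eq_norm_sq, RCLike.ofReal_real_eq_id, id] at h2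
  rw [← h2, Real.sqrt_sq A.normDet_nonneg]

/-! ### The divergence theorem on a half space. -/

section HalfSpace

variable {W Y V : Type*} [NormedAddCommGroup W] [InnerProductSpace ℝ W] [FiniteDimensional ℝ W]
  [MeasurableSpace W] [BorelSpace W] [NormedAddCommGroup Y] [NormedSpace ℝ Y]
  [NormedAddCommGroup V] [NormedSpace ℝ V]

/-- Integration by parts against the constant function `1`. -/
theorem integral_hasFDerivAt_eq_zero {g : W → V} {g' : W → W →L[ℝ] V} (u : W)
    (hg : ∀ w, HasFDerivAt g (g' w) w) (hint : Integrable g) (hint' : Integrable fun w => g' w u) :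
    ∫ w, g' w u = 0 := by
  have := integral_bilinear_hasFDerivAt_right_eq_neg_left_of_integrable (μ := volume)
    (f := fun _ : W => (1 : ℝ)) (f' := fun _ => 0) (g := g) (g' := g') (v := u)
    (B := ContinuousLinearMap.lsmul ℝ ℝ) (by simp) (by simpa using hint') (by simpa using hint)
    (fun x _ => hasFDerivAt_const _ _) (fun x _ => hg x)
  simpa using this

theorem integrableOn_of_continuousOn_of_eq_zero {V : Type*} [NormedAddCommGroup V] {X : Type*} [TopologicalSpace X] [T2Space X]
    [MeasurableSpace X] [OpensMeasurableSpace X]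
    [TopologicalSpace.PseudoMetrizableSpace X] {μ : Measure X} [IsFiniteMeasureOnCompacts μ]
    {f : X → V} {s K : Set X} (hs : IsClosed s) (hK : IsCompact K) (hf : ContinuousOn f s)
    (h0 : ∀ x ∉ K, f x = 0) : IntegrableOn f s μ := by
  have h1 : IntegrableOn f (s ∩ K) μ :=
    (hf.mono inter_subset_left).integrableOn_compact (hK.inter_left hs)
  exact h1.of_forall_sdiff_eq_zero hs.measurableSet fun x hx => h0 x fun hxK => hx.2 ⟨hx.1, hxK⟩

theorem fderiv_eq_zero_of_notMem {X : Type*} [NormedAddCommGroup X] [NormedSpace ℝ X]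
    {G : X → V} {K : Set X} (hK : IsClosed K) (h0 : ∀ x ∉ K, G x = 0) {x : X} (hx : x ∉ K) :
    fderiv ℝ G x = 0 := by
  have : G =ᶠ[𝓝 x] fun _ => 0 := by
    filter_upwards [hK.isOpen_compl.mem_nhds hx] with z hz using h0 z hz
  rw [this.fderiv_eq]; simp

/-- The divergence theorem on the half space `t < τ`, `τ < 0`, for a field which is `C¹` on `t < 0`
and vanishes off a compact set. -/
theorem setIntegral_divergence_Iic {G : W × ℝ → Y →L[ℝ] V} {K : Set (W × ℝ)}
    [CompleteSpace V] (hK : IsCompact K) (h0 : ∀ p ∉ K, G p = 0)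
    (hG : ContDiffOn ℝ 1 G {p | p.2 < 0}) {ι : Type*} [Fintype ι] (b : ι → W) (c : ι → Y)
    {N : W → Y} (hN : Continuous N) {τ : ℝ} (hτ : τ < 0) :
    ∫ p in univ ×ˢ Iic τ, (∑ i, fderiv ℝ G p (b i, 0) (c i) + fderiv ℝ G p (0, 1) (N p.1)) =
      ∫ w, G (w, τ) (N w) := by
  have hO : IsOpen {p : W × ℝ | p.2 < 0} := isOpen_lt continuous_snd continuous_const
  have hS : IsClosed ((univ : Set W) ×ˢ Iic τ) := isClosed_univ.prod isClosed_Iic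
  have hsub : (univ : Set W) ×ˢ Iic τ ⊆ {p | p.2 < 0} := fun p hp => lt_of_le_of_lt hp.2 hτ
  have hdiff : ∀ p : W × ℝ, p.2 < 0 → HasFDerivAt G (fderiv ℝ G p) p := fun p hp =>
    ((hG.differentiableOn one_ne_zero).differentiableAt (hO.mem_nhds hp)).hasFDerivAt
  have hcD : ContinuousOn (fderiv ℝ G) (univ ×ˢ Iic τ) :=
    (hG.continuousOn_fderiv_of_isOpen hO le_rfl).mono hsub
  have hD0 : ∀ p ∉ K, fderiv ℝ G p = 0 := fun p hp => fderiv_eq_zero_of_notMem hK.isClosed h0 hp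
  have hi1 : ∀ i, IntegrableOn (fun p => fderiv ℝ G p (b i, 0) (c i)) (univ ×ˢ Iic τ) := fun i =>
    integrableOn_of_continuousOn_of_eq_zero hS hK
      ((hcD.clm_apply continuousOn_const).clm_apply continuousOn_const)
      fun p hp => by rw [hD0 p hp]; simp
  have hi2 : IntegrableOn (fun p => fderiv ℝ G p (0, 1) (N p.1)) (univ ×ˢ Iic τ) :=
    integrableOn_of_continuousOn_of_eq_zero hS hK
      ((hcD.clm_apply continuousOn_const).clm_apply (by fun_prop))
      fun p hp => by rw [hD0 p hp]; simp
  have hslice : ∀ t ≤ τ, ∀ w, HasFDerivAt (fun w => G (w, t))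
      ((fderiv ℝ G (w, t)).comp (ContinuousLinearMap.inl ℝ W ℝ)) w := fun t ht w =>
    (hdiff (w, t) (lt_of_le_of_lt ht hτ)).comp w (hasFDerivAt_prodMk_left w t)
  have hK1 : IsCompact (Prod.fst '' K) := hK.image continuous_fst
  rw [integral_add (integrable_finsetSum _ fun i _ => hi1 i) hi2,
    integral_finsetSum _ fun i _ => hi1 i]
  -- Tangential derivatives integrate to zero on every horizontal slice, by Fubini with the `W`
  -- variable inside.
  have hz : ∀ i, ∫ p in univ ×ˢ Iic τ, fderiv ℝ G p (b i, 0) (c i) = 0 := by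
    intro i
    have hint := hi1 i
    rw [IntegrableOn, Measure.volume_eq_prod, ← Measure.prod_restrict] at hint
    rw [Measure.volume_eq_prod, ← Measure.prod_restrict, integral_prod_symm _ hint]
    refine (setIntegral_congr_fun measurableSet_Iic fun t (ht : t ≤ τ) => ?_).trans
      (integral_zero _ _)
    simp only [Measure.restrict_univ]
    have hcont : Continuous fun w => G (w, t) :=
      continuous_iff_continuousAt.2 fun w => (hslice t ht w).continuousAt
    have hder : ∀ w, HasFDerivAt (fun w => G (w, t) (c i))
        ((ContinuousLinearMap.apply ℝ V (c i)).comp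
          ((fderiv ℝ G (w, t)).comp (ContinuousLinearMap.inl ℝ W ℝ))) w := fun w =>
      (ContinuousLinearMap.apply ℝ V (c i)).hasFDerivAt.comp w (hslice t ht w)
    have hout : ∀ w ∉ Prod.fst '' K, (w, t) ∉ K := fun w hw hwK => hw ⟨_, hwK, rfl⟩
    refine integral_hasFDerivAt_eq_zero (b i) hder ?_ ?_
    · rw [← integrableOn_univ]
      exact integrableOn_of_continuousOn_of_eq_zero isClosed_univ hK1
        (hcont.clm_apply continuous_const).continuousOn
        fun w hw => by rw [h0 _ (hout w hw)]; simp
    · rw [← integrableOn_univ]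
      refine integrableOn_of_continuousOn_of_eq_zero isClosed_univ hK1 ?_
        fun w hw => by simp [hD0 _ (hout w hw)]
      have : ContinuousOn (fun w : W => fderiv ℝ G (w, t)) univ :=
        hcD.comp (by fun_prop) fun w _ => ⟨mem_univ _, ht⟩
      exact (this.clm_apply continuousOn_const).clm_apply continuousOn_const
  rw [Finset.sum_eq_zero fun i _ => hz i, zero_add]
  have hint := hi2
  rw [IntegrableOn, Measure.volume_eq_prod, ← Measure.prod_restrict, Measure.restrict_univ] at hint
  rw [Measure.volume_eq_prod, ← Measure.prod_restrict, Measure.restrict_univ,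
    integral_prod _ hint]
  refine integral_congr_ae ?_
  filter_upwards [hint.prod_right_ae] with w hw
  -- Since `N` depends on `w` alone, the remaining term is an exact derivative along vertical lines;
  -- the fundamental theorem of calculus leaves only the value at `τ`.
  have hder : ∀ t ≤ τ, HasDerivAt (fun t => G (w, t) (N w)) (fderiv ℝ G (w, t) (0, 1) (N w)) t := by
    intro t ht
    have h1 : HasDerivAt (fun t : ℝ => (w, t)) ((0 : W), (1 : ℝ)) t :=
      (hasDerivAt_const t w).prodMk (hasDerivAt_id t)
    have h2 := (hdiff (w, t) (lt_of_le_of_lt ht hτ)).comp_hasDerivAt t h1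
    exact (ContinuousLinearMap.apply ℝ V (N w)).hasFDerivAt.comp_hasDerivAt t h2
  have hK2 : IsCompact (Prod.snd '' K) := hK.image continuous_snd
  have hlim : Tendsto (fun t => G (w, t) (N w)) atBot (𝓝 0) := by
    refine tendsto_const_nhds.congr' ?_
    obtain ⟨m, hm⟩ := hK2.bddBelow
    filter_upwards [eventually_lt_atBot m] with t ht
    rw [h0 (w, t) fun hK => absurd (hm ⟨_, hK, rfl⟩) (not_le.2 ht)]
    simp
  have := integral_Iic_of_hasDerivAt_of_tendsto (hder τ le_rfl).continuousAt.continuousWithinAt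
    (fun t ht => hder t (le_of_lt ht)) hw hlim
  simpa using this

/-- The divergence theorem on the half space `t < 0`, for a compactly supported field which is `C¹`
inside and continuous up to the boundary. -/
theorem setIntegral_divergence_halfSpace [CompleteSpace V] {G : W × ℝ → Y →L[ℝ] V} {K : Set (W × ℝ)}
    (hK : IsCompact K) (h0 : ∀ p ∉ K, G p = 0) (hG : ContDiffOn ℝ 1 G {p | p.2 < 0})
    (hGc : ContinuousOn G {p | p.2 ≤ 0}) {ι : Type*} [Fintype ι] (b : ι → W) (c : ι → Y)
    {N : W → Y} (hN : Continuous N)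
    (hint : IntegrableOn
      (fun p => ∑ i, fderiv ℝ G p (b i, 0) (c i) + fderiv ℝ G p (0, 1) (N p.1)) {p | p.2 < 0}) :
    ∫ p in {p : W × ℝ | p.2 < 0},
        (∑ i, fderiv ℝ G p (b i, 0) (c i) + fderiv ℝ G p (0, 1) (N p.1)) =
      ∫ w, G (w, 0) (N w) := by
  -- The field is `C¹` only for `t < 0`, so the half spaces `t ≤ τ n` increase to the open one.
  -- Integrability of the divergence handles the volume side, continuity up to `t = 0` the boundary
  -- side.
  set τ : ℕ → ℝ := fun n => -(1 / ((n : ℝ) + 1)) with hτ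
  have hτ0 : ∀ n, τ n < 0 := fun n => neg_lt_zero.2 Nat.one_div_pos_of_nat
  have hτl : Tendsto τ atTop (𝓝 0) := by
    simpa [hτ] using (tendsto_one_div_add_atTop_nhds_zero_nat (𝕜 := ℝ)).neg
  have hτm : Monotone τ := fun m n h => neg_le_neg (Nat.one_div_le_one_div h)
  have hU : (⋃ n, (univ : Set W) ×ˢ Iic (τ n)) = {p | p.2 < 0} := by
    ext p
    simp only [mem_iUnion, mem_prod, mem_univ, true_and, mem_Iic, mem_ofPred_eq]
    constructor
    · rintro ⟨n, hn⟩; exact lt_of_le_of_lt hn (hτ0 n)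
    · intro hp
      exact (hτl.eventually (lt_mem_nhds hp)).exists.imp fun n hn => le_of_lt hn
  have hL := tendsto_setIntegral_of_monotone (μ := (volume : Measure (W × ℝ)))
    (f := fun p => ∑ i, fderiv ℝ G p (b i, 0) (c i) + fderiv ℝ G p (0, 1) (N p.1))
    (fun n => (MeasurableSet.univ.prod (measurableSet_Iic (a := τ n))))
    (fun m n h => prod_mono_right (Iic_subset_Iic.2 (hτm h))) (by rw [hU]; exact hint)
  rw [hU] at hL
  refine tendsto_nhds_unique hL ?_
  simp only [setIntegral_divergence_Iic hK h0 hG b c hN (hτ0 _)]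
  have hK1 : IsCompact (Prod.fst '' K) := hK.image continuous_fst
  have hout : ∀ t, ∀ w ∉ Prod.fst '' K, (w, t) ∉ K := fun t w hw hwK => hw ⟨_, hwK, rfl⟩
  have hcl : IsClosed {p : W × ℝ | p.2 ≤ 0} := isClosed_le continuous_snd continuous_const
  obtain ⟨C, hC⟩ := (hK.inter_left hcl).exists_bound_of_continuousOn (hGc.mono inter_subset_left)
  obtain ⟨C', hC'⟩ := hK1.exists_bound_of_continuousOn hN.continuousOn
  have hslice : ∀ t ≤ 0, Continuous fun w => G (w, t) := fun t ht =>
    continuousOn_univ.1 (hGc.comp (by fun_prop) fun w _ => ht)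
  -- Absolute values are needed because a bound over a possibly empty compact set may be negative.
  refine tendsto_integral_of_dominated_convergence
    (indicator (Prod.fst '' K) fun _ => |C| * |C'|) (fun n => ?_) ?_ (fun n => ?_) ?_
  · exact ((hslice _ (hτ0 n).le).clm_apply hN).aestronglyMeasurable
  · exact (integrable_indicator_iff hK1.measurableSet).2
      (integrableOn_const hK1.measure_lt_top.ne)
  · refine Eventually.of_forall fun w => ?_
    by_cases hw : w ∈ Prod.fst '' K
    · rw [indicator_of_mem hw]
      by_cases hp : (w, τ n) ∈ K
      · have h1 := (hC _ ⟨(hτ0 n).le, hp⟩).trans (le_abs_self C)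
        exact (ContinuousLinearMap.le_opNorm _ _).trans
          (mul_le_mul h1 ((hC' w hw).trans (le_abs_self C')) (norm_nonneg _) (abs_nonneg C))
      · rw [h0 _ hp]
        simpa using mul_nonneg (abs_nonneg C) (abs_nonneg C')
    · rw [indicator_of_notMem hw, h0 _ (hout _ w hw)]; simp
  · refine Eventually.of_forall fun w => ?_
    have h1 : Tendsto (fun n => G (w, τ n)) atTop (𝓝 (G (w, 0))) := by
      refine (hGc (w, 0) (le_refl (0 : ℝ))).tendsto.comp
        (tendsto_nhdsWithin_iff.2 ⟨?_, Eventually.of_forall fun n => (hτ0 n).le⟩)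
      exact tendsto_const_nhds.prodMk_nhds hτl
    exact ((ContinuousLinearMap.apply ℝ V (N w)).continuous.tendsto _).comp h1

end HalfSpace

set_option linter.unusedSectionVars false

noncomputable section

open Module

/-! ### Divergence of vector-valued one-forms. -/

section Divergence

variable {E V : Type*} [NormedAddCommGroup E] [InnerProductSpace ℝ E] [FiniteDimensional ℝ E]
  [NormedAddCommGroup V] [NormedSpace ℝ V]

/-- The divergence of a `V`-valued field, given as a `V`-valued `1`-form. -/
def divergence (F : E → E →L[ℝ] V) (x : E) : V :=
  ∑ i, fderiv ℝ F x (stdOrthonormalBasis ℝ E i) (stdOrthonormalBasis ℝ E i)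

/-- Expanding `b i` in the basis `c` and using Parseval for `b` leaves only the diagonal terms. This
permits a basis adapted to a graph in one place and the standard basis in another. -/
theorem sum_apply_orthonormalBasis_eq {ι κ : Type*} [Fintype ι] [Fintype κ]
    (B : E →L[ℝ] E →L[ℝ] V) (b : OrthonormalBasis ι ℝ E) (c : OrthonormalBasis κ ℝ E) :
    ∑ i, B (b i) (b i) = ∑ j, B (c j) (c j) := by
  classical
  have h1 : ∀ i, B (b i) (b i) = ∑ j, ∑ l, (⟪c j, b i⟫_ℝ * ⟪b i, c l⟫_ℝ) • B (c j) (c l) := by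
    intro i
    conv_lhs => rw [← c.sum_repr' (b i)]
    simp only [map_sum, map_smul, _root_.sum_apply, smul_apply,
      Finset.smul_sum, smul_smul]
    rw [Finset.sum_comm]
    refine Finset.sum_congr rfl fun j _ => Finset.sum_congr rfl fun l _ => ?_
    rw [real_inner_comm (c l), mul_comm]
  simp only [h1]
  rw [Finset.sum_comm]
  refine Finset.sum_congr rfl fun j _ => ?_
  rw [Finset.sum_comm]
  simp only [← Finset.sum_smul, b.sum_inner_mul_inner]
  rw [Finset.sum_eq_single j]
  · simp
  · intro l _ hl
    rw [c.orthonormal.inner_eq_zero hl.symm, zero_smul]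
  · simp

theorem divergence_eq_sum {ι : Type*} [Fintype ι] (b : OrthonormalBasis ι ℝ E)
    (F : E → E →L[ℝ] V) (x : E) : divergence F x = ∑ i, fderiv ℝ F x (b i) (b i) :=
  sum_apply_orthonormalBasis_eq _ _ _

end Divergence

/-! ### Graphs over a hyperplane and the divergence theorem below them. -/

section Frame

variable {W E V : Type*} [NormedAddCommGroup W] [InnerProductSpace ℝ W] [FiniteDimensional ℝ W]
  [NormedAddCommGroup E] [InnerProductSpace ℝ E] [FiniteDimensional ℝ E]
  [NormedAddCommGroup V] [NormedSpace ℝ V]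

/-- The identification of `W × ℝ` with `E` given by an orthogonal decomposition of `E`. -/
def frame (L : WithLp 2 (W × ℝ) ≃ₗᵢ[ℝ] E) : (W × ℝ) ≃L[ℝ] E :=
  (WithLp.prodContinuousLinearEquiv 2 ℝ W ℝ).symm.trans L.toContinuousLinearEquiv

theorem inner_frame (L : WithLp 2 (W × ℝ) ≃ₗᵢ[ℝ] E) (p q : W × ℝ) :
    ⟪frame L p, frame L q⟫_ℝ = ⟪p.1, q.1⟫_ℝ + p.2 * q.2 := by
  have : ⟪frame L p, frame L q⟫_ℝ = ⟪WithLp.toLp 2 p, WithLp.toLp 2 q⟫_ℝ :=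
    L.inner_map_map _ _
  rw [this, WithLp.prod_inner_apply]
  simp [mul_comm]

theorem measurePreserving_frame [MeasurableSpace W] [BorelSpace W] [MeasurableSpace E]
    [BorelSpace E] (L : WithLp 2 (W × ℝ) ≃ₗᵢ[ℝ] E) : MeasurePreserving (frame L) :=
  L.measurePreserving.comp (WithLp.volume_preserving_toLp W ℝ)

theorem divergence_frame {ι : Type*} [Fintype ι] (L : WithLp 2 (W × ℝ) ≃ₗᵢ[ℝ] E)
    (b : OrthonormalBasis ι ℝ W) (F : E → E →L[ℝ] V) (x : E) :
    divergence F x = ∑ i, fderiv ℝ F x (frame L (b i, 0)) (frame L (b i, 0)) +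
      fderiv ℝ F x (frame L (0, 1)) (frame L (0, 1)) := by
  rw [divergence_eq_sum ((b.prod (OrthonormalBasis.singleton Unit ℝ)).map L), Fintype.sum_sum_type]
  simp [frame]

/-- The parametrization of the graph of `h`. -/
def graphMap (L : WithLp 2 (W × ℝ) ≃ₗᵢ[ℝ] E) (h : W → ℝ) (w : W) : E := frame L (w, h w)

/-- The unit normal of the graph of `h`, pointing upwards. -/
def graphNormal (L : WithLp 2 (W × ℝ) ≃ₗᵢ[ℝ] E) (h : W → ℝ) (w : W) : E :=
  (√(1 + ‖gradient h w‖ ^ 2))⁻¹ • frame L (-gradient h w, 1)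

theorem hasFDerivAt_graphMap (L : WithLp 2 (W × ℝ) ≃ₗᵢ[ℝ] E) {h : W → ℝ} (hh : ContDiff ℝ 1 h)
    (w : W) : HasFDerivAt (graphMap L h)
      ((frame L : W × ℝ →L[ℝ] E).comp ((ContinuousLinearMap.id ℝ W).prod (fderiv ℝ h w))) w :=
  (frame L : W × ℝ →L[ℝ] E).hasFDerivAt.comp w
    ((hasFDerivAt_id w).prodMk ((hh.differentiable one_ne_zero).differentiableAt.hasFDerivAt))

theorem contDiff_graphMap (L : WithLp 2 (W × ℝ) ≃ₗᵢ[ℝ] E) {h : W → ℝ} (hh : ContDiff ℝ 1 h) :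
    ContDiff ℝ 1 (graphMap L h) :=
  (frame L).contDiff.comp (contDiff_id.prodMk hh)

theorem graphMap_injective (L : WithLp 2 (W × ℝ) ≃ₗᵢ[ℝ] E) (h : W → ℝ) :
    Function.Injective (graphMap L h) := fun _ _ hxy =>
  congrArg Prod.fst ((frame L).injective hxy)

theorem continuous_gradient {h : W → ℝ} (hh : ContDiff ℝ 1 h) : Continuous (gradient h) :=
  (InnerProductSpace.toDual ℝ W).symm.continuous.comp (hh.continuous_fderiv one_ne_zero)

/-- The derivative `u ↦ (u, dh u)` has Gram form `⟪u, v⟫ + ⟪∇h, u⟫ ⟪∇h, v⟫`, so the area formula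
gives the usual surface element. -/
theorem restrict_range_graphMap [MeasurableSpace W] [BorelSpace W] [MeasurableSpace E]
    [BorelSpace E] (L : WithLp 2 (W × ℝ) ≃ₗᵢ[ℝ] E) {h : W → ℝ} (hh : ContDiff ℝ 1 h) :
    (Measure.euclideanHausdorffMeasure (finrank ℝ W)).restrict (range (graphMap L h)) =
      ((volume : Measure W).withDensity
        fun w => ENNReal.ofReal √(1 + ‖gradient h w‖ ^ 2)).map (graphMap L h) := by
  have hder : ∀ w, fderiv ℝ (graphMap L h) w =
      (frame L : W × ℝ →L[ℝ] E).comp ((ContinuousLinearMap.id ℝ W).prod (fderiv ℝ h w)) :=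
    fun w => (hasFDerivAt_graphMap L hh w).fderiv
  rw [restrict_range_euclideanHausdorffMeasure (contDiff_graphMap L hh) (graphMap_injective L h)]
  · congr 2
    ext w
    rw [normDet_graph (p := gradient h w)]
    intro u v
    rw [hder]
    simp [inner_frame, inner_gradient_left]
  · intro w u v huv
    rw [hder] at huv
    simpa using congrArg Prod.fst ((frame L).injective huv)

variable [MeasurableSpace W] [BorelSpace W] [MeasurableSpace E] [BorelSpace E]

theorem measurable_jacobian {h : W → ℝ} (hh : ContDiff ℝ 1 h) :
    Measurable fun w => ENNReal.ofReal √(1 + ‖gradient h w‖ ^ 2) := by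
  have := continuous_gradient hh
  exact (by fun_prop : Continuous fun w => √(1 + ‖gradient h w‖ ^ 2)).measurable.ennreal_ofReal

theorem integral_range_graphMap (L : WithLp 2 (W × ℝ) ≃ₗᵢ[ℝ] E) {h : W → ℝ} (hh : ContDiff ℝ 1 h)
    (g : E → V) :
    ∫ x in range (graphMap L h), g x ∂(Measure.euclideanHausdorffMeasure (finrank ℝ W)) =
      ∫ w, √(1 + ‖gradient h w‖ ^ 2) • g (graphMap L h w) := by
  have hemb := (contDiff_graphMap L hh).continuous.measurableEmbedding (graphMap_injective L h)
  rw [restrict_range_graphMap L hh, hemb.integral_map,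
    integral_withDensity_eq_integral_toReal_smul (measurable_jacobian hh) (by simp)]
  simp [ENNReal.toReal_ofReal, Real.sqrt_nonneg]

theorem integrableOn_range_graphMap_iff (L : WithLp 2 (W × ℝ) ≃ₗᵢ[ℝ] E) {h : W → ℝ}
    (hh : ContDiff ℝ 1 h) (g : E → V) :
    IntegrableOn g (range (graphMap L h)) (Measure.euclideanHausdorffMeasure (finrank ℝ W)) ↔
      Integrable fun w => √(1 + ‖gradient h w‖ ^ 2) • g (graphMap L h w) := by
  have hemb := (contDiff_graphMap L hh).continuous.measurableEmbedding (graphMap_injective L h)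
  rw [IntegrableOn, restrict_range_graphMap L hh, hemb.integrable_map_iff,
    integrable_withDensity_iff_integrable_smul' (measurable_jacobian hh) (by simp)]
  simp [ENNReal.toReal_ofReal, Real.sqrt_nonneg]

/-- The shear straightening the graph of `h`. -/
def shear (L : WithLp 2 (W × ℝ) ≃ₗᵢ[ℝ] E) {h : W → ℝ} (hh : Continuous h) : W × ℝ ≃ₜ E :=
  Homeomorph.trans
    { toFun := fun p => (p.1, h p.1 + p.2)
      invFun := fun p => (p.1, p.2 - h p.1)
      left_inv := fun p => by simp
      right_inv := fun p => by simp
      continuous_toFun := by fun_prop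
      continuous_invFun := by fun_prop } (frame L).toHomeomorph

theorem shear_apply (L : WithLp 2 (W × ℝ) ≃ₗᵢ[ℝ] E) {h : W → ℝ} (hh : Continuous h) (p : W × ℝ) :
    shear L hh p = frame L (p.1, h p.1 + p.2) := rfl

/-- The shear translates each vertical line, and is followed by an isometric identification. -/
theorem measurePreserving_shear (L : WithLp 2 (W × ℝ) ≃ₗᵢ[ℝ] E) {h : W → ℝ} (hh : Continuous h) :
    MeasurePreserving (shear L hh) := by
  refine (measurePreserving_frame L).comp ?_
  exact (MeasurePreserving.id (volume : Measure W)).skew_product (g := fun w t => h w + t)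
    (by fun_prop) (Eventually.of_forall fun w => map_add_left_eq_self volume (h w))

theorem contDiff_shear (L : WithLp 2 (W × ℝ) ≃ₗᵢ[ℝ] E) {h : W → ℝ} (hh : ContDiff ℝ 1 h) :
    ContDiff ℝ 1 (shear L hh.continuous) :=
  (frame L).contDiff.comp (contDiff_fst.prodMk ((hh.comp contDiff_fst).add contDiff_snd))

/-- The open region below the graph of `h`. -/
def belowGraph (L : WithLp 2 (W × ℝ) ≃ₗᵢ[ℝ] E) (h : W → ℝ) : Set E :=
  {x | ((frame L).symm x).2 < h ((frame L).symm x).1}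

theorem shear_preimage_belowGraph (L : WithLp 2 (W × ℝ) ≃ₗᵢ[ℝ] E) {h : W → ℝ} (hh : Continuous h) :
    shear L hh ⁻¹' belowGraph L h = {p | p.2 < 0} := by
  ext p
  simp [belowGraph, shear_apply]

/-- In sheared coordinates the tangential derivative along `b i` acquires `∂_i h` times the vertical
derivative. Collecting these corrections turns the vertical vector into the unnormalized normal
`(-∇h, 1)`. -/
theorem divergence_shear {ι : Type*} [Fintype ι] (L : WithLp 2 (W × ℝ) ≃ₗᵢ[ℝ] E)
    (b : OrthonormalBasis ι ℝ W) {h : W → ℝ} (hh : ContDiff ℝ 1 h) {F : E → E →L[ℝ] V} {p : W × ℝ}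
    (hF : DifferentiableAt ℝ F (shear L hh.continuous p)) :
    divergence F (shear L hh.continuous p) =
      ∑ i, fderiv ℝ (F ∘ shear L hh.continuous) p (b i, 0) (frame L (b i, 0)) +
        fderiv ℝ (F ∘ shear L hh.continuous) p (0, 1) (frame L (-gradient h p.1, 1)) := by
  set Θ := shear L hh.continuous with hΘ
  have hder : HasFDerivAt Θ ((frame L : W × ℝ →L[ℝ] E).comp
      ((ContinuousLinearMap.fst ℝ W ℝ).prod ((fderiv ℝ h p.1).comp (ContinuousLinearMap.fst ℝ W ℝ) +
        ContinuousLinearMap.snd ℝ W ℝ))) p :=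
    (frame L : W × ℝ →L[ℝ] E).hasFDerivAt.comp p (hasFDerivAt_fst.prodMk
      (((hh.differentiable one_ne_zero).differentiableAt.hasFDerivAt.comp p hasFDerivAt_fst).add
        hasFDerivAt_snd))
  rw [(hF.hasFDerivAt.comp p hder).fderiv, divergence_frame L b]
  set B := fderiv ℝ F (Θ p)
  have e1 : ∀ (w : W) (t : ℝ), frame L (w, t) = frame L (w, 0) + t • frame L (0, 1) := by
    intro w t
    rw [← map_smul, ← map_add]; simp
  have e2 : frame L (-gradient h p.1, 0) = -∑ i, fderiv ℝ h p.1 (b i) • frame L (b i, 0) := by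
    conv_lhs => rw [← b.sum_repr' (gradient h p.1)]
    have : ∀ u : W, frame L (u, 0) =
      ((frame L : W × ℝ →L[ℝ] E).comp (ContinuousLinearMap.inl ℝ W ℝ)) u := fun u => rfl
    simp only [this, map_neg, map_sum, map_smul]
    congr 1
    refine Finset.sum_congr rfl fun i _ => ?_
    rw [real_inner_comm, inner_gradient_left]
  simp only [ContinuousLinearMap.comp_apply, ContinuousLinearMap.prod_apply,
    add_apply, ContinuousLinearMap.coe_fst', ContinuousLinearMap.coe_snd',
    map_zero, add_zero, zero_add, ContinuousLinearEquiv.coe_coe]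
  rw [e1 (-gradient h p.1) 1, e2]
  conv_rhs =>
    enter [1, 2, i]
    rw [e1 (b i) (fderiv ℝ h p.1 (b i))]
  simp only [map_add, map_smul, add_apply, smul_apply,
    one_smul, Finset.sum_add_distrib, map_neg, map_sum]
  abel

/-- The divergence theorem for the region below the graph of a `C¹` function. -/
theorem integral_divergence_belowGraph [CompleteSpace V] (L : WithLp 2 (W × ℝ) ≃ₗᵢ[ℝ] E) {h : W → ℝ}
    (hh : ContDiff ℝ 1 h) {F : E → E →L[ℝ] V} {K : Set E} (hK : IsCompact K)
    (h0 : ∀ x ∉ K, F x = 0) (hF : ContDiffOn ℝ 1 F (belowGraph L h))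
    (hFc : ContinuousOn F {x | ((frame L).symm x).2 ≤ h ((frame L).symm x).1})
    (hint : IntegrableOn (divergence F) (belowGraph L h)) (n : E → E)
    (hn : ∀ w, graphMap L h w ∈ K → n (graphMap L h w) = graphNormal L h w) :
    ∫ x in belowGraph L h, divergence F x =
      ∫ x in range (graphMap L h), F x (n x)
        ∂(Measure.euclideanHausdorffMeasure (finrank ℝ W)) := by
  set Θ := shear L hh.continuous with hΘ
  have hpre : Θ ⁻¹' belowGraph L h = {p | p.2 < 0} := shear_preimage_belowGraph L hh.continuous
  have hopen : IsOpen (belowGraph L h) := by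
    have := hh.continuous
    exact isOpen_lt (by fun_prop) (by fun_prop)
  have hO : IsOpen {p : W × ℝ | p.2 < 0} := isOpen_lt continuous_snd continuous_const
  have hmp := measurePreserving_shear L hh.continuous
  have hemb : MeasurableEmbedding Θ := Θ.measurableEmbedding
  rw [← hmp.setIntegral_preimage_emb hemb, hpre]
  rw [← hmp.integrableOn_comp_preimage hemb, hpre] at hint
  set b := stdOrthonormalBasis ℝ W
  have hdiv : EqOn (divergence F ∘ Θ) (fun p =>
      ∑ i, fderiv ℝ (F ∘ Θ) p (b i, 0) (frame L (b i, 0)) +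
        fderiv ℝ (F ∘ Θ) p (0, 1) (frame L (-gradient h p.1, 1))) {p | p.2 < 0} := by
    intro p hp
    refine divergence_shear L b hh ?_
    refine (hF.differentiableOn one_ne_zero).differentiableAt (hopen.mem_nhds ?_)
    rwa [← hpre] at hp
  have hN : Continuous fun w => frame L (-gradient h w, 1) := by
    have := continuous_gradient hh
    fun_prop
  rw [integrableOn_congr_fun hdiv hO.measurableSet] at hint
  have hcong : ∫ p in {p : W × ℝ | p.2 < 0}, divergence F (Θ p) = ∫ p in {p : W × ℝ | p.2 < 0},
      (∑ i, fderiv ℝ (F ∘ Θ) p (b i, 0) (frame L (b i, 0)) +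
        fderiv ℝ (F ∘ Θ) p (0, 1) (frame L (-gradient h p.1, 1))) :=
    setIntegral_congr_fun hO.measurableSet hdiv
  rw [hcong, setIntegral_divergence_halfSpace (G := F ∘ Θ) (K := Θ ⁻¹' K) (Θ.isCompact_preimage.2 hK)
    (fun p hp => h0 _ hp) ?_ ?_ _ _ hN hint, integral_range_graphMap L hh]
  · refine integral_congr_ae (Eventually.of_forall fun w => ?_)
    have hw : Θ (w, 0) = graphMap L h w := by simp [hΘ, shear_apply, graphMap]
    simp only [Function.comp_apply, hw]
    by_cases hwK : graphMap L h w ∈ K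
    -- The surface element cancels the normalization of the unit normal.
    · rw [hn w hwK, graphNormal, map_smul, smul_smul, mul_inv_cancel₀, one_smul]
      positivity
    · rw [h0 _ hwK]; simp
  · exact hF.comp (contDiff_shear L hh).contDiffOn fun p hp => by
      rwa [← hpre] at hp
  · refine hFc.comp Θ.continuous.continuousOn fun p (hp : p.2 ≤ 0) => ?_
    simp [hΘ, shear_apply, hp]

end Frame

end

noncomputable section

open Module

/-! ### `C¹` boundaries are locally graphs -/

section LocalGraph

variable {k : ℕ}

theorem exists_frame_apply_eq (v : E k) (hv : ‖v‖ = 1) :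
    ∃ L : WithLp 2 (EuclideanSpace ℝ (Fin (k + 1)) × ℝ) ≃ₗᵢ[ℝ] E k, frame L (0, 1) = v := by
  have hrank : finrank ℝ (WithLp 2 (EuclideanSpace ℝ (Fin (k + 1)) × ℝ)) = finrank ℝ (E k) := by
    rw [(WithLp.linearEquiv 2 ℝ (EuclideanSpace ℝ (Fin (k + 1)) × ℝ)).finrank_eq]
    simp
  let L₁ := (stdOrthonormalBasis ℝ (WithLp 2 (EuclideanSpace ℝ (Fin (k + 1)) × ℝ))).equiv
    (stdOrthonormalBasis ℝ (E k)) (finCongr hrank)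
  set u := frame L₁ (0, 1) with hu
  have hu1 : ‖u‖ = ‖v‖ := by
    have h1 : ‖u‖ ^ 2 = 1 := by
      rw [← real_inner_self_eq_norm_sq, hu, inner_frame]; simp
    rw [hv]
    exact (pow_eq_one_iff_of_nonneg (norm_nonneg u) two_ne_zero).1 h1
  -- An arbitrary isometry is corrected by the reflection that sends `u` to `v`.
  exact ⟨L₁.trans (ℝ ∙ (u - v))ᗮ.reflection, Submodule.reflection_sub hu1⟩

/-- Multiplying by a bump function makes the implicit function globally defined, so that graphs are
taken over the whole hyperplane. -/
theorem exists_contDiff_eventuallyEq {W : Type*} [NormedAddCommGroup W] [InnerProductSpace ℝ W]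
    [FiniteDimensional ℝ W] {g : W → ℝ} {w : W} (hg : ContDiffAt ℝ 1 g w) :
    ∃ h : W → ℝ, ContDiff ℝ 1 h ∧ h =ᶠ[𝓝 w] g := by
  obtain ⟨r, hr, hgr⟩ := Metric.eventually_nhds_iff_ball.1 (hg.eventually (by simp))
  let χ : ContDiffBump w := ⟨r / 4, r / 2, by positivity, by linarith⟩
  refine ⟨fun z => χ z * g z, contDiff_iff_contDiffAt.2 fun z => ?_, ?_⟩
  · by_cases hz : z ∈ Metric.ball w r
    · exact χ.contDiffAt.mul (hgr z hz)
    · have hz' : z ∉ tsupport χ := by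
        rw [χ.tsupport_eq]
        exact fun h => hz (Metric.closedBall_subset_ball (by simp [χ, hr]) h)
      refine (contDiffAt_const (c := (0 : ℝ))).congr_of_eventuallyEq ?_
      filter_upwards [notMem_tsupport_iff_eventuallyEq.1 hz'] with x hx
      simp [hx]
  · filter_upwards [χ.eventuallyEq_one] with z hz
    simp [hz]

/-- With the vertical axis along the gradient of `φ`, the implicit function theorem writes the zero
set as a graph. The vertical derivative is positive nearby, so the sign of `φ` tells on which side
of the graph a point lies. -/
theorem IsLocalDefiningFunction.exists_belowGraph {U : Set (E k)} {a : E k} {φ : E k → ℝ}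
    (hφ : IsLocalDefiningFunction U a φ) :
    ∃ (L : WithLp 2 (EuclideanSpace ℝ (Fin (k + 1)) × ℝ) ≃ₗᵢ[ℝ] E k)
      (h : EuclideanSpace ℝ (Fin (k + 1)) → ℝ), ContDiff ℝ 1 h ∧
      ∀ᶠ x in 𝓝 a, x ∈ U ↔ x ∈ belowGraph L h := by
  have hg0 : 0 < ‖gradient φ a‖ := norm_pos_iff.2 hφ.gradient_ne_zero
  obtain ⟨L, hL⟩ := exists_frame_apply_eq (‖gradient φ a‖⁻¹ • gradient φ a)
    (by rw [norm_smul, norm_inv, norm_norm, inv_mul_cancel₀ hg0.ne'])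
  set p := (frame L).symm a with hp
  have hpa : frame L p = a := (frame L).apply_symm_apply a
  set ψ : EuclideanSpace ℝ (Fin (k + 1)) × ℝ → ℝ := φ ∘ frame L with hψ
  have hψ1 : ContDiffAt ℝ 1 ψ p := by
    refine ContDiffAt.comp p ?_ (frame L).contDiff.contDiffAt
    rw [hpa]; exact hφ.contDiffAt
  have hder : fderiv ℝ ψ p (0, 1) = ‖gradient φ a‖ := by
    have h1 : HasFDerivAt φ (fderiv ℝ φ a) (frame L p) := by
      rw [hpa]; exact (hφ.contDiffAt.differentiableAt one_ne_zero).hasFDerivAt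
    rw [(h1.comp p (frame L).hasFDerivAt).fderiv]
    show fderiv ℝ φ a (frame L (0, 1)) = _
    rw [hL, map_smul, ← inner_gradient_left, real_inner_self_eq_norm_sq, smul_eq_mul, sq,
      inv_mul_cancel_left₀ hg0.ne']
  have hinv : (fderiv ℝ ψ p ∘L .inr ℝ (EuclideanSpace ℝ (Fin (k + 1))) ℝ).IsInvertible := by
    refine ⟨ContinuousLinearEquiv.unitsEquivAut ℝ (Units.mk0 _ hg0.ne'), ?_⟩
    ext
    simp [hder]
  set h₀ := hψ1.implicitFunction one_ne_zero hinv with hh₀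
  have hh₀p : h₀ p.1 = p.2 := hψ1.implicitFunction_apply_self one_ne_zero hinv
  have hψp : ψ p = 0 := by simp [hψ, hpa, hφ.apply_eq_zero]
  have hC := hψ1.contDiffAt_implicitFunction one_ne_zero hinv
  obtain ⟨h, hh, hhe⟩ := exists_contDiff_eventuallyEq hC
  refine ⟨L, h, hh, ?_⟩
  have hcd : ContinuousAt (fun q => fderiv ℝ ψ q (0, 1)) p := by
    have : ContinuousAt (fderiv ℝ ψ) p := (hψ1.fderiv_right (m := 0) (by simp)).continuousAt
    exact this.clm_apply continuousAt_const
  have e1 : ∀ᶠ q in 𝓝 p, 0 < fderiv ℝ ψ q (0, 1) :=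
    hcd.eventually (lt_mem_nhds (hg0.trans_eq hder.symm))
  have e2 := hψ1.eventually_apply_eq_iff_implicitFunction one_ne_zero hinv
  have e3 : ∀ᶠ q in 𝓝 p, ContDiffAt ℝ 1 ψ q := hψ1.eventually (by simp)
  have e4 : ∀ᶠ q in 𝓝 p, frame L q ∈ U ↔ ψ q < 0 := by
    have : Tendsto (frame L) (𝓝 p) (𝓝 a) := by
      simpa [hpa] using (frame L).continuous.tendsto p
    exact this.eventually hφ.mem_iff
  obtain ⟨δ, hδ, hball⟩ := Metric.eventually_nhds_iff_ball.1 (e1.and (e2.and (e3.and e4)))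
  have e5 : ∀ᶠ w in 𝓝 p.1, h₀ w ∈ Metric.ball p.2 δ := by
    have : ContinuousAt h₀ p.1 := hC.continuousAt
    refine this.eventually (IsOpen.mem_nhds Metric.isOpen_ball ?_)
    rw [hh₀p]; exact Metric.mem_ball_self hδ
  have hsymm : Tendsto (frame L).symm (𝓝 a) (𝓝 p) := (frame L).symm.continuous.tendsto a
  have hfst : Tendsto (fun x => ((frame L).symm x).1) (𝓝 a) (𝓝 p.1) :=
    (continuous_fst.tendsto p).comp hsymm
  filter_upwards [hsymm.eventually (Metric.ball_mem_nhds p hδ), hfst.eventually e5,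
    hfst.eventually hhe] with x hx hx5 hxh
  set q := (frame L).symm x with hq
  have hqx : frame L q = x := (frame L).apply_symm_apply x
  -- Balls for the sup metric on the product are boxes, so they contain the vertical segments used
  -- for monotonicity.
  have hmem : ∀ t ∈ Metric.ball p.2 δ, (q.1, t) ∈ Metric.ball p δ := fun t ht => by
    rw [Prod.dist_eq, max_lt_iff] at hx
    rw [Metric.mem_ball, Prod.dist_eq, max_lt_iff]
    exact ⟨hx.1, ht⟩
  have hq2 : q.2 ∈ Metric.ball p.2 δ := by
    rw [Prod.dist_eq, max_lt_iff] at hx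
    exact hx.2
  have hdt : ∀ t ∈ Metric.ball p.2 δ,
      HasDerivAt (fun t => ψ (q.1, t)) (fderiv ℝ ψ (q.1, t) (0, 1)) t := by
    intro t ht
    exact ((hball _ (hmem t ht)).2.2.1.differentiableAt one_ne_zero).hasFDerivAt.comp_hasDerivAt t
      ((hasDerivAt_const t q.1).prodMk (hasDerivAt_id t))
  have hmono : StrictMonoOn (fun t => ψ (q.1, t)) (Metric.ball p.2 δ) := by
    refine strictMonoOn_of_deriv_pos (convex_ball _ _)
      (fun t ht => (hdt t ht).continuousAt.continuousWithinAt) fun t ht => ?_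
    rw [Metric.isOpen_ball.interior_eq] at ht
    rw [(hdt t ht).deriv]
    exact (hball _ (hmem t ht)).1
  have hz : ψ (q.1, h₀ q.1) = 0 := by
    rw [← hψp]; exact (hball _ (hmem _ hx5)).2.1.2 rfl
  have := hmono.lt_iff_lt hq2 hx5
  simp only [hz] at this
  have h4 := (hball q hx).2.2.2
  rw [hqx] at h4
  rw [h4, belowGraph, mem_ofPred_eq, ← hq, hxh]
  exact this

variable {U : Set (E k)} {L : WithLp 2 (EuclideanSpace ℝ (Fin (k + 1)) × ℝ) ≃ₗᵢ[ℝ] E k}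
  {h : EuclideanSpace ℝ (Fin (k + 1)) → ℝ} {O : Set (E k)}

theorem mem_range_graphMap {x : E k} :
    x ∈ range (graphMap L h) ↔ ((frame L).symm x).2 = h ((frame L).symm x).1 := by
  constructor
  · rintro ⟨w, rfl⟩; simp [graphMap]
  · intro hx
    refine ⟨((frame L).symm x).1, ?_⟩
    rw [graphMap, ← hx]
    exact (frame L).apply_symm_apply x

/-- Points on or below the graph are limits of points strictly lower. This transfers continuity on
`closure U` to the closed region below the graph. -/
theorem mem_closure_of_graph (hO : IsOpen O)
    (hUO : ∀ x ∈ O, x ∈ U ↔ x ∈ belowGraph L h) {x : E k} (hx : x ∈ O)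
    (hle : ((frame L).symm x).2 ≤ h ((frame L).symm x).1) : x ∈ closure U := by
  have hlim : Tendsto (fun t : ℝ => x - t • frame L (0, 1)) (𝓝[>] 0) (𝓝 x) := by
    have : Continuous fun t : ℝ => x - t • frame L (0, 1) := by fun_prop
    simpa using (this.tendsto 0).mono_left nhdsWithin_le_nhds
  refine mem_closure_of_tendsto hlim ?_
  filter_upwards [hlim.eventually (hO.mem_nhds hx), self_mem_nhdsWithin] with t ht (ht0 : 0 < t)
  rw [hUO _ ht, belowGraph, mem_ofPred_eq]
  simp only [map_sub, map_smul, ContinuousLinearEquiv.symm_apply_apply, Prod.fst_sub, Prod.snd_sub,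
    Prod.smul_fst, Prod.smul_snd, smul_zero, sub_zero, smul_eq_mul, mul_one]
  linarith

theorem frontier_inter_eq_of_graph (hU : IsOpen U) (hh : Continuous h) (hO : IsOpen O)
    (hUO : ∀ x ∈ O, x ∈ U ↔ x ∈ belowGraph L h) :
    frontier U ∩ O = range (graphMap L h) ∩ O := by
  ext x
  refine and_congr_left fun hx => ?_
  rw [mem_range_graphMap, hU.frontier_eq]
  constructor
  · rintro ⟨hcl, hnU⟩
    refine le_antisymm ?_ (not_lt.1 fun hlt => hnU ((hUO x hx).2 hlt))
    by_contra! hlt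
    have hop : IsOpen {z | h ((frame L).symm z).1 < ((frame L).symm z).2} :=
      isOpen_lt (by fun_prop) (by fun_prop)
    obtain ⟨z, hz, hzU⟩ := mem_closure_iff.1 hcl _ (hO.inter hop) ⟨hx, hlt⟩
    have h1 : ((frame L).symm z).2 < h ((frame L).symm z).1 := (hUO z hz.1).1 hzU
    exact lt_asymm hz.2 h1
  · intro heq
    refine ⟨mem_closure_of_graph hO hUO hx heq.le, fun hxU => ?_⟩
    exact absurd ((hUO x hx).1 hxU) (not_lt.2 heq.ge)

/-- Height minus `h` is itself a local defining function, and the outer normal is independent of the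
choice. -/
theorem outerNormal_graphMap (hh : ContDiff ℝ 1 h) (hO : IsOpen O)
    (hUO : ∀ x ∈ O, x ∈ U ↔ x ∈ belowGraph L h) {w : EuclideanSpace ℝ (Fin (k + 1))}
    (hw : graphMap L h w ∈ O) : outerNormal U (graphMap L h w) = graphNormal L h w := by
  set φ : E k → ℝ := fun x => ((frame L).symm x).2 - h ((frame L).symm x).1 with hφ
  have hgrad : HasGradientAt φ (frame L (-gradient h w, 1)) (graphMap L h w) := by
    have h1 : HasFDerivAt (frame L).symm ((frame L).symm : E k →L[ℝ] _) (graphMap L h w) :=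
      (frame L).symm.hasFDerivAt
    have hfst : ((frame L).symm (graphMap L h w)).1 = w := by simp [graphMap]
    have h2 : HasFDerivAt h (fderiv ℝ h w) ((frame L).symm (graphMap L h w)).1 := by
      rw [hfst]; exact (hh.differentiable one_ne_zero).differentiableAt.hasFDerivAt
    have h3 := (hasFDerivAt_snd.comp (graphMap L h w) h1).sub
      (h2.comp (graphMap L h w) (hasFDerivAt_fst.comp (graphMap L h w) h1))
    rw [hasGradientAt_iff_hasFDerivAt]
    refine h3.congr_fderiv (ContinuousLinearMap.ext fun x => ?_)
    obtain ⟨q, rfl⟩ := (frame L).surjective x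
    simp [inner_frame, inner_gradient_left]
    ring
  have hne : frame L (-gradient h w, 1) ≠ 0 := by simp
  have hnorm : ‖frame L (-gradient h w, 1)‖ = √(1 + ‖gradient h w‖ ^ 2) := by
    rw [norm_eq_sqrt_real_inner, inner_frame]
    simp [add_comm]
  have hdef : IsLocalDefiningFunction U (graphMap L h w) φ :=
    { contDiffAt := by
        have : ContDiff ℝ 1 φ :=
          (contDiff_snd.comp (frame L).symm.contDiff).sub
            (hh.comp (contDiff_fst.comp (frame L).symm.contDiff))
        exact this.contDiffAt
      apply_eq_zero := by simp [hφ, graphMap]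
      gradient_ne_zero := by rw [hgrad.gradient]; exact hne
      mem_iff := by
        filter_upwards [hO.mem_nhds hw] with z hz
        rw [hUO z hz, belowGraph, mem_ofPred_eq, hφ, sub_neg] }
  rw [hdef.outerNormal_eq, hgrad.gradient, hnorm, graphNormal]

theorem HasC1Boundary.exists_graph (hC1 : HasC1Boundary U) {a : E k} (ha : a ∈ frontier U) :
    ∃ (L : WithLp 2 (EuclideanSpace ℝ (Fin (k + 1)) × ℝ) ≃ₗᵢ[ℝ] E k)
      (h : EuclideanSpace ℝ (Fin (k + 1)) → ℝ) (O : Set (E k)), ContDiff ℝ 1 h ∧ IsOpen O ∧ a ∈ O ∧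
      ∀ x ∈ O, x ∈ U ↔ x ∈ belowGraph L h := by
  obtain ⟨φ, hφ⟩ := hC1 a ha
  obtain ⟨L, h, hh, hev⟩ := hφ.exists_belowGraph
  obtain ⟨O, hO, hOo, haO⟩ := eventually_nhds_iff.1 hev
  exact ⟨L, h, O, hh, hOo, haO, hO⟩

end LocalGraph

end

set_option linter.unusedSectionVars false

noncomputable section

open Module

/-! ### Rules for the divergence. -/

section DivergenceRules

variable {X V : Type*} [NormedAddCommGroup X] [InnerProductSpace ℝ X] [FiniteDimensional ℝ X]
  [NormedAddCommGroup V] [NormedSpace ℝ V]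

theorem divergence_eq_zero_of_notMem {F : X → X →L[ℝ] V} {K : Set X} (hK : IsClosed K)
    (h0 : ∀ x ∉ K, F x = 0) {x : X} (hx : x ∉ K) : divergence F x = 0 := by
  simp [divergence, fderiv_eq_zero_of_notMem hK h0 hx]

theorem divergence_congr {F G : X → X →L[ℝ] V} {x : X} (h : F =ᶠ[𝓝 x] G) :
    divergence F x = divergence G x := by
  simp only [divergence, h.fderiv_eq]

theorem divergence_add {F G : X → X →L[ℝ] V} {x : X} (hF : DifferentiableAt ℝ F x)
    (hG : DifferentiableAt ℝ G x) :
    divergence (fun x => F x + G x) x = divergence F x + divergence G x := by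
  simp [divergence, fderiv_fun_add hF hG, Finset.sum_add_distrib]

theorem divergence_smul {χ : X → ℝ} {F : X → X →L[ℝ] V} {x : X} (hχ : DifferentiableAt ℝ χ x)
    (hF : DifferentiableAt ℝ F x) :
    divergence (fun x => χ x • F x) x = χ x • divergence F x + F x (gradient χ x) := by
  have h1 : F x (gradient χ x) = ∑ i, fderiv ℝ χ x (stdOrthonormalBasis ℝ X i) •
      F x (stdOrthonormalBasis ℝ X i) := by
    conv_lhs => rw [← (stdOrthonormalBasis ℝ X).sum_repr' (gradient χ x)]
    simp only [map_sum, map_smul]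
    refine Finset.sum_congr rfl fun i _ => ?_
    rw [real_inner_comm, inner_gradient_left]
  rw [h1, divergence, divergence, fderiv_fun_smul hχ hF, Finset.smul_sum, ← Finset.sum_add_distrib]
  simp

end DivergenceRules

/-! ### The divergence theorem on bounded domains with `C¹` boundary. -/

section DivergenceTheorem

variable {k : ℕ} {V : Type*} [NormedAddCommGroup V] [NormedSpace ℝ V] {U : Set (E k)}

local notation "σ" => (Measure.euclideanHausdorffMeasure (k + 1) : Measure (E k))

theorem finrank_euclideanSpace_fin_succ :
    finrank ℝ (EuclideanSpace ℝ (Fin (k + 1))) = k + 1 := by simp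

theorem isCompact_frontier (hbdd : Bornology.IsBounded U) : IsCompact (frontier U) :=
  Metric.isCompact_of_isClosed_isBounded isClosed_frontier
    (hbdd.closure.subset frontier_subset_closure)

/-- The flux density of a field continuous on the boundary is integrable. -/
theorem integrableOn_flux (hU : IsOpen U) (hbdd : Bornology.IsBounded U) (hC1 : HasC1Boundary U)
    {F : E k → E k →L[ℝ] V} (hF : ContinuousOn F (frontier U)) :
    IntegrableOn (fun x => F x (outerNormal U x)) (frontier U) σ := by
  refine LocallyIntegrableOn.integrableOn_isCompact (fun a ha => ?_) (isCompact_frontier hbdd)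
  obtain ⟨L, h, O, hh, hO, haO, hUO⟩ := hC1.exists_graph ha
  have hfr := frontier_inter_eq_of_graph hU hh.continuous hO hUO
  obtain ⟨r, hr, hrO⟩ := Metric.nhds_basis_closedBall.mem_iff.1 (hO.mem_nhds haO)
  refine ⟨frontier U ∩ Metric.closedBall a r,
    inter_mem self_mem_nhdsWithin (mem_nhdsWithin_of_mem_nhds (Metric.closedBall_mem_nhds a hr)), ?_⟩
  set B := Metric.closedBall a r with hB
  have hBm : MeasurableSet B := Metric.isClosed_closedBall.measurableSet
  have hset : frontier U ∩ B = range (graphMap L h) ∩ B := by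
    rw [← inter_eq_right.2 hrO, ← inter_assoc, hfr, inter_assoc]
  have hcont := (contDiff_graphMap L hh).continuous
  set Φ := graphMap L h with hΦ
  have hemb := hcont.measurableEmbedding (graphMap_injective L h)
  -- Inside `B` the frontier is the graph, and the normal, defined by a choice at each point, agrees
  -- there with the continuous graph normal.
  have hind : IntegrableOn (B.indicator fun x => F x (outerNormal U x)) (range Φ) σ := by
    have hiff := integrableOn_range_graphMap_iff L hh
      (B.indicator fun x => F x (outerNormal U x))
    rw [finrank_euclideanSpace_fin_succ] at hiff
    rw [hiff]
    have hcomp : IsCompact (Φ ⁻¹' B) := by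
      have hc : IsCompact (Prod.fst '' ((frame L).symm '' B)) :=
        ((isCompact_closedBall a r).image (frame L).symm.continuous).image continuous_fst
      refine hc.of_isClosed_subset (Metric.isClosed_closedBall.preimage hcont) fun w hw => ?_
      exact ⟨_, ⟨_, hw, rfl⟩, by simp [hΦ, graphMap]⟩
    have heq : (fun w => √(1 + ‖gradient h w‖ ^ 2) •
        (B.indicator fun x => F x (outerNormal U x)) (Φ w)) =
        (Φ ⁻¹' B).indicator fun w => √(1 + ‖gradient h w‖ ^ 2) • F (Φ w) (graphNormal L h w) := by
      ext w
      by_cases hw : Φ w ∈ B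
      · rw [indicator_of_mem hw, indicator_of_mem (by exact hw),
          outerNormal_graphMap hh hO hUO (hrO hw)]
      · rw [indicator_of_notMem hw, indicator_of_notMem (by exact hw), smul_zero]
    rw [heq, integrable_indicator_iff hcomp.measurableSet]
    refine ContinuousOn.integrableOn_compact hcomp ?_
    have hg := continuous_gradient hh
    have hn : Continuous (graphNormal L h) := by
      have h1 : Continuous fun w => √(1 + ‖gradient h w‖ ^ 2) := by fun_prop
      have h2 : Continuous fun w => frame L (-gradient h w, 1) := by fun_prop
      exact (h1.inv₀ fun w => by positivity).smul h2
    have hFΦ : ContinuousOn (fun w => F (Φ w)) (Φ ⁻¹' B) := by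
      refine hF.comp hcont.continuousOn fun w hw => ?_
      have : Φ w ∈ range Φ ∩ B := ⟨⟨w, rfl⟩, hw⟩
      rw [← hset] at this
      exact this.1
    exact ContinuousOn.smul (by fun_prop) (hFΦ.clm_apply hn.continuousOn)
  rw [hset, inter_comm]
  have := hind.mono_measure (μ := σ) le_rfl
  rwa [IntegrableOn, integrable_indicator_iff hBm, IntegrableOn,
    Measure.restrict_restrict hBm] at this

/-- A field vanishing off a compact subset of `O` cannot distinguish `U` from the region below the
graph: both integrals may be restricted to `O` and then extended to the graph region. -/
theorem setIntegral_divergence_of_subset_graph [CompleteSpace V] (hU : IsOpen U)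
    {L : WithLp 2 (EuclideanSpace ℝ (Fin (k + 1)) × ℝ) ≃ₗᵢ[ℝ] E k}
    {h : EuclideanSpace ℝ (Fin (k + 1)) → ℝ} (hh : ContDiff ℝ 1 h) {O : Set (E k)} (hO : IsOpen O)
    (hUO : ∀ x ∈ O, x ∈ U ↔ x ∈ belowGraph L h)
    {F : E k → E k →L[ℝ] V} {K : Set (E k)} (hK : IsCompact K) (hKO : K ⊆ O)
    (h0 : ∀ x ∉ K, F x = 0) (hF : ContDiffOn ℝ 1 F U) (hFc : ContinuousOn F (closure U))
    (hint : IntegrableOn (divergence F) U) :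
    ∫ x in U, divergence F x = ∫ x in frontier U, F x (outerNormal U x) ∂σ := by
  have hdiv0 : ∀ x ∉ K, divergence F x = 0 := fun x hx =>
    divergence_eq_zero_of_notMem hK.isClosed h0 hx
  have hzero : ∀ x ∉ K, F =ᶠ[𝓝 x] fun _ => 0 := fun x hx => by
    filter_upwards [hK.isClosed.isOpen_compl.mem_nhds hx] with z hz using h0 z hz
  have hcont := hh.continuous
  have hDo : IsOpen (belowGraph L h) := isOpen_lt (by fun_prop) (by fun_prop)
  have hset : U ∩ O = belowGraph L h ∩ O := by
    ext x; exact and_congr_left fun hx => hUO x hx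
  have hfr := frontier_inter_eq_of_graph hU hcont hO hUO
  have hemb := (contDiff_graphMap L hh).continuous.measurableEmbedding (graphMap_injective L h)
  have hFD : ContDiffOn ℝ 1 F (belowGraph L h) := by
    intro x hx
    by_cases hxK : x ∈ K
    · exact (hF.contDiffAt (hU.mem_nhds ((hUO x (hKO hxK)).2 hx))).contDiffWithinAt
    · exact (contDiffAt_const.congr_of_eventuallyEq (hzero x hxK)).contDiffWithinAt
  have hFDc : ContinuousOn F {x | ((frame L).symm x).2 ≤ h ((frame L).symm x).1} := by
    intro x hx
    by_cases hxK : x ∈ K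
    · have h1 := hFc x (mem_closure_of_graph hO hUO (hKO hxK) hx)
      refine h1.mono_of_mem_nhdsWithin ?_
      filter_upwards [self_mem_nhdsWithin, mem_nhdsWithin_of_mem_nhds (hO.mem_nhds (hKO hxK))]
        with z hz hzO using mem_closure_of_graph hO hUO hzO hz
    · exact (continuousAt_const.congr (hzero x hxK).symm).continuousWithinAt
  have hintD : IntegrableOn (divergence F) (belowGraph L h) := by
    have h1 : IntegrableOn (divergence F) (belowGraph L h ∩ O) := by
      rw [← hset]; exact hint.mono_set inter_subset_left
    exact h1.of_forall_sdiff_eq_zero hDo.measurableSet fun x hx =>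
      hdiv0 x fun hxK => hx.2 ⟨hx.1, hKO hxK⟩
  have hmain := integral_divergence_belowGraph L hh hK h0 hFD hFDc hintD (outerNormal U)
    fun w hw => outerNormal_graphMap hh hO hUO (hKO hw)
  rw [finrank_euclideanSpace_fin_succ] at hmain
  have hfl0 : ∀ x ∉ K, F x (outerNormal U x) = 0 := fun x hx => by simp [h0 x hx]
  rw [setIntegral_eq_of_subset_of_forall_sdiff_eq_zero hU.measurableSet
      (inter_subset_left : U ∩ O ⊆ U) fun x hx => hdiv0 x fun hxK => hx.2 ⟨hx.1, hKO hxK⟩,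
    hset, ← setIntegral_eq_of_subset_of_forall_sdiff_eq_zero hDo.measurableSet inter_subset_left
      fun x hx => hdiv0 x fun hxK => hx.2 ⟨hx.1, hKO hxK⟩, hmain,
    setIntegral_eq_of_subset_of_forall_sdiff_eq_zero hemb.measurableSet_range
      (inter_subset_left : range (graphMap L h) ∩ O ⊆ _)
      fun x hx => hfl0 x fun hxK => hx.2 ⟨hx.1, hKO hxK⟩, ← hfr,
    ← setIntegral_eq_of_subset_of_forall_sdiff_eq_zero isClosed_frontier.measurableSet
      inter_subset_left fun x hx => hfl0 x fun hxK => hx.2 ⟨hx.1, hKO hxK⟩]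

theorem integrable_of_continuous_of_eq_zero {f : E k → V} {K : Set (E k)}
    (hK : IsCompact K) (hf : Continuous f) (h0 : ∀ x ∉ K, f x = 0) : Integrable f :=
  hf.integrable_of_hasCompactSupport (HasCompactSupport.intro hK h0)

/-- Such a field is globally `C¹` with compact support, so each partial derivative integrates to
zero, and the flux vanishes because the support misses the frontier. -/
theorem setIntegral_divergence_of_subset [CompleteSpace V] (hU : IsOpen U)
    {F : E k → E k →L[ℝ] V} {K : Set (E k)} (hK : IsCompact K) (hKU : K ⊆ U)
    (h0 : ∀ x ∉ K, F x = 0) (hF : ContDiffOn ℝ 1 F U) :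
    ∫ x in U, divergence F x = ∫ x in frontier U, F x (outerNormal U x) ∂σ := by
  have hzero : ∀ x ∉ K, F =ᶠ[𝓝 x] fun _ => 0 := fun x hx => by
    filter_upwards [hK.isClosed.isOpen_compl.mem_nhds hx] with z hz using h0 z hz
  have hC : ContDiff ℝ 1 F := contDiff_iff_contDiffAt.2 fun x => by
    by_cases hx : x ∈ K
    · exact hF.contDiffAt (hU.mem_nhds (hKU hx))
    · exact contDiffAt_const.congr_of_eventuallyEq (hzero x hx)
  have hfl : ∫ x in frontier U, F x (outerNormal U x) ∂σ = 0 := by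
    refine setIntegral_eq_zero_of_forall_eq_zero fun x hx => ?_
    have : x ∉ K := fun hxK => by
      rw [hU.frontier_eq] at hx; exact hx.2 (hKU hxK)
    simp [h0 x this]
  have hsum : ∀ x, divergence F x = ∑ i, fderiv ℝ F x (stdOrthonormalBasis ℝ (E k) i)
    (stdOrthonormalBasis ℝ (E k) i) := fun x => rfl
  rw [hfl, setIntegral_eq_integral_of_forall_compl_eq_zero fun x hx =>
    divergence_eq_zero_of_notMem hK.isClosed h0 fun hxK => hx (hKU hxK)]
  simp only [hsum]
  have hcd := hC.continuous_fderiv one_ne_zero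
  have hi : ∀ u v : E k, Integrable fun x => fderiv ℝ F x u v := fun u v =>
    integrable_of_continuous_of_eq_zero hK (by fun_prop) fun x hx => by
      simp [fderiv_eq_zero_of_notMem hK.isClosed h0 hx]
  rw [integral_finsetSum _ fun i _ => hi _ _]
  refine Finset.sum_eq_zero fun i _ => ?_
  set v := stdOrthonormalBasis ℝ (E k) i
  refine integral_hasFDerivAt_eq_zero (g := fun x => F x v)
    (g' := fun x => (ContinuousLinearMap.apply ℝ V v).comp (fderiv ℝ F x)) v (fun x => ?_) ?_ ?_
  · exact (ContinuousLinearMap.apply ℝ V v).hasFDerivAt.comp x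
      (hC.differentiable one_ne_zero).differentiableAt.hasFDerivAt
  · have := hC.continuous
    exact integrable_of_continuous_of_eq_zero hK (by fun_prop) fun x hx => by simp [h0 x hx]
  · exact hi v v

/-- Localization keeps the integrability hypothesis: the extra term `F (∇χ)` is continuous on the
compact closure. -/
theorem integrableOn_divergence_smul (hU : IsOpen U) (hbdd : Bornology.IsBounded U)
    {F : E k → E k →L[ℝ] V} (hF : ContDiffOn ℝ 1 F U) (hFc : ContinuousOn F (closure U))
    (hint : IntegrableOn (divergence F) U) {χ : E k → ℝ} (hχ : ContDiff ℝ 1 χ) :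
    IntegrableOn (divergence fun x => χ x • F x) U := by
  have hcl : IsCompact (closure U) := hbdd.isCompact_closure
  have heq : EqOn (divergence fun x => χ x • F x)
      (fun x => χ x • divergence F x + F x (gradient χ x)) U := fun x hx =>
    divergence_smul (hχ.differentiable one_ne_zero).differentiableAt
      ((hF.differentiableOn one_ne_zero).differentiableAt (hU.mem_nhds hx))
  rw [integrableOn_congr_fun heq hU.measurableSet]
  obtain ⟨C, hC⟩ := hcl.exists_bound_of_continuousOn hχ.continuous.continuousOn
  refine Integrable.add ?_ ?_
  · refine Integrable.bdd_smul hint C hχ.continuous.aestronglyMeasurable ?_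
    exact (ae_restrict_iff' hU.measurableSet).2 (Eventually.of_forall fun x hx =>
      hC x (subset_closure hx))
  · have hg := continuous_gradient hχ
    exact (ContinuousOn.integrableOn_compact hcl (hFc.clm_apply hg.continuousOn)).mono_set
      subset_closure

/-- **The divergence theorem** on bounded open sets with `C¹` boundary, for a field continuous up
to the boundary, `C¹` inside, and with integrable divergence. -/
theorem setIntegral_divergence [CompleteSpace V] (hU : IsOpen U) (hbdd : Bornology.IsBounded U)
    (hC1 : HasC1Boundary U) {F : E k → E k →L[ℝ] V} (hF : ContDiffOn ℝ 1 F U)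
    (hFc : ContinuousOn F (closure U)) (hint : IntegrableOn (divergence F) U) :
    ∫ x in U, divergence F x = ∫ x in frontier U, F x (outerNormal U x) ∂σ := by
  have hcl : IsCompact (closure U) := hbdd.isCompact_closure
  -- Compactness induction replaces a partition of unity. The property quantifies over all fields
  -- supported in a neighbourhood of `s`, so that a field can be split when two sets are united.
  let p : Set (E k) → Prop := fun s => ∃ O, IsOpen O ∧ s ⊆ O ∧ ∀ (F : E k → E k →L[ℝ] V)
    (K : Set (E k)), IsCompact K → K ⊆ O → (∀ x ∉ K, F x = 0) → ContDiffOn ℝ 1 F U →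
    ContinuousOn F (closure U) → IntegrableOn (divergence F) U →
    ∫ x in U, divergence F x = ∫ x in frontier U, F x (outerNormal U x) ∂σ
  have hp : p (closure U) := by
    refine hcl.induction_on ?_ ?_ ?_ ?_
    · refine ⟨∅, isOpen_empty, Subset.rfl, fun F K hK hKO h0 hF _ _ => ?_⟩
      exact setIntegral_divergence_of_subset hU hK (hKO.trans (empty_subset _)) h0 hF
    · rintro s t hst ⟨O, hO, htO, h⟩
      exact ⟨O, hO, hst.trans htO, h⟩
    · rintro s t ⟨O₁, hO₁, hs, h₁⟩ ⟨O₂, hO₂, ht, h₂⟩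
      refine ⟨O₁ ∪ O₂, hO₁.union hO₂, union_subset_union hs ht,
        fun F K hK hKO h0 hF hFc hint => ?_⟩
      -- The part of `K` not covered by `O₂` is compact in `O₁`. With `χ = 1` near it and `χ = 0`
      -- off `T ⊆ O₁`, the field `χ F` belongs to `O₁` and `(1 - χ) F` to `O₂`.
      have hKd : IsCompact (K \ O₂) := hK.diff hO₂
      obtain ⟨T, hT, hKT, hTO⟩ := exists_compact_between hKd hO₁
        (fun x hx => (hKO hx.1).resolve_right hx.2)
      obtain ⟨χ, hχ1, hχ0, -⟩ := exists_contMDiffMap_one_nhds_of_subset_interior (n := 1)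
        (modelWithCornersSelf ℝ (E k)) hKd.isClosed hKT
      have hχ : ContDiff ℝ 1 (fun x => χ x) := χ.contMDiff.contDiff
      have hχ' : ContDiff ℝ 1 (fun x => 1 - χ x) := contDiff_const.sub hχ
      have hFd : ∀ x ∈ U, DifferentiableAt ℝ F x := fun x hx =>
        (hF.differentiableOn one_ne_zero).differentiableAt (hU.mem_nhds hx)
      have i1 := integrableOn_divergence_smul hU hbdd hF hFc hint hχ
      have i2 := integrableOn_divergence_smul hU hbdd hF hFc hint hχ'
      have c1 : ContinuousOn (fun x => χ x • F x) (closure U) := hχ.continuous.continuousOn.smul hFc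
      have c2 : ContinuousOn (fun x => (1 - χ x) • F x) (closure U) :=
        hχ'.continuous.continuousOn.smul hFc
      have r1 := h₁ (fun x => χ x • F x) T hT hTO (fun x hx => by simp [hχ0 x hx])
        (hχ.contDiffOn.smul hF) c1 i1
      have r2 := h₂ (fun x => (1 - χ x) • F x) (K \ interior {x | χ x = 1})
        (hK.diff isOpen_interior) (fun x hx => ?_) (fun x hx => ?_)
        (hχ'.contDiffOn.smul hF) c2 i2
      · have hsum : ∀ x, χ x • F x + (1 - χ x) • F x = F x := fun x => by module
        have hdsum : ∫ x in U, divergence F x =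
            ∫ x in U, (divergence (fun x => χ x • F x) x +
              divergence (fun x => (1 - χ x) • F x) x) := by
          refine setIntegral_congr_fun hU.measurableSet fun x hx => ?_
          have := divergence_add ((hχ.differentiable one_ne_zero x).fun_smul (hFd x hx))
            ((hχ'.differentiable one_ne_zero x).fun_smul (hFd x hx))
          rw [← this]
          simp only [hsum]
        rw [hdsum, integral_add i1 i2, r1, r2, ← integral_add
          (integrableOn_flux hU hbdd hC1 (c1.mono frontier_subset_closure))
          (integrableOn_flux hU hbdd hC1 (c2.mono frontier_subset_closure))]
        refine integral_congr_ae (Eventually.of_forall fun x => ?_)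
        simp only [← _root_.add_apply, hsum]
      · by_contra hxO
        exact hx.2 (subset_interior_iff_mem_nhdsSet.2 hχ1 ⟨hx.1, hxO⟩)
      · by_cases hxK : x ∈ K
        · have : χ x = 1 := by
            have hxi : x ∈ interior {x | χ x = 1} := by_contra fun h => hx ⟨hxK, h⟩
            exact (interior_subset : interior {x | χ x = 1} ⊆ _) hxi
          simp [this]
        · simp [h0 x hxK]
    · intro a ha
      by_cases haU : a ∈ U
      · exact ⟨U, mem_nhdsWithin_of_mem_nhds (hU.mem_nhds haU), U, hU, Subset.rfl,
          fun F K hK hKO h0 hF _ _ => setIntegral_divergence_of_subset hU hK hKO h0 hF⟩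
      · obtain ⟨L, h, O, hh, hO, haO, hUO⟩ :=
          hC1.exists_graph (by rw [hU.frontier_eq]; exact ⟨ha, haU⟩)
        exact ⟨O, mem_nhdsWithin_of_mem_nhds (hO.mem_nhds haO), O, hO, Subset.rfl,
          fun F K hK hKO h0 hF hFc hint =>
            setIntegral_divergence_of_subset_graph hU hh hO hUO hK hKO h0 hF hFc hint⟩
  obtain ⟨O, -, hUO, hO⟩ := hp
  -- Values outside the closure are irrelevant to both sides; setting them to zero supplies the
  -- compact support required by `p`.
  have heq : EqOn ((closure U).indicator F) F (closure U) := fun x hx => indicator_of_mem hx _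
  have hdeq : EqOn (divergence ((closure U).indicator F)) (divergence F) U := fun x hx => by
    refine divergence_congr ?_
    filter_upwards [hU.mem_nhds hx] with z hz using heq (subset_closure hz)
  have := hO ((closure U).indicator F) (closure U) hcl hUO (fun x hx => indicator_of_notMem hx _)
    (hF.congr fun x hx => heq (subset_closure hx)) (hFc.congr heq)
    ((integrableOn_congr_fun hdeq hU.measurableSet).2 hint)
  rw [setIntegral_congr_fun hU.measurableSet hdeq] at this
  rw [this]
  refine setIntegral_congr_fun isClosed_frontier.measurableSet fun x hx => ?_
  simp only [heq (frontier_subset_closure hx)]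

end DivergenceTheorem

end

noncomputable section

/-! ### Clifford algebra identities -/

section Clifford

variable {k : ℕ}

theorem vec_add (x y : E k) : vec (x + y) = vec x + vec y := map_add _ _ _

theorem vec_smul (c : ℝ) (x : E k) : vec (c • x) = c • vec x := map_smul _ _ _

theorem vec_mul_self (x : E k) : vec x * vec x = (-‖x‖ ^ 2) • (1 : Cl k) := by
  rw [vec, CliffordAlgebra.ι_sq_scalar, negForm_apply, Algebra.algebraMap_eq_smul_one]

theorem vec_mul_vec_add_swap (x y : E k) :
    vec x * vec y + vec y * vec x = (-2 * ⟪x, y⟫_ℝ) • (1 : Cl k) := by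
  have h := vec_mul_self (x + y)
  rw [vec_add, add_mul, mul_add, mul_add, vec_mul_self, vec_mul_self, norm_add_sq_real] at h
  have h2 : vec x * vec y + vec y * vec x =
      (-(‖x‖ ^ 2 + 2 * ⟪x, y⟫_ℝ + ‖y‖ ^ 2)) • (1 : Cl k) + ‖x‖ ^ 2 • (1 : Cl k) +
        ‖y‖ ^ 2 • (1 : Cl k) := by
    rw [← h]; module
  rw [h2]; module

theorem sum_inner_stdVec_smul (x : E k) : ∑ j, ⟪x, stdVec j⟫_ℝ • stdVec j = x := by
  have := (EuclideanSpace.basisFun (Fin (k + 2)) ℝ).sum_repr' x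
  simp only [EuclideanSpace.basisFun_apply] at this
  conv_rhs => rw [← this]
  exact Finset.sum_congr rfl fun j _ => by rw [real_inner_comm]; rfl

theorem sum_inner_smul_gen (x : E k) : ∑ j, ⟪x, stdVec j⟫_ℝ • gen j = vec x := by
  conv_rhs => rw [← sum_inner_stdVec_smul x, vec, map_sum]
  exact Finset.sum_congr rfl fun j _ => (map_smul _ _ _).symm

theorem gen_mul_self (j : Fin (k + 2)) : gen j * gen j = -(1 : Cl k) := by
  rw [gen, vec_mul_self]; simp [stdVec]

theorem lastCoord_eq_inner (x : E k) : lastCoord x = ⟪x, stdVec (Fin.last (k + 1))⟫_ℝ := by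
  simp [lastCoord, stdVec, EuclideanSpace.inner_single_right]

theorem inner_stdVec_last_self :
    ⟪stdVec (Fin.last (k + 1)), stdVec (k := k) (Fin.last (k + 1))⟫_ℝ = 1 := by
  simp [stdVec]

/-- The component of `x` orthogonal to `e_n`. -/
def horizontal (x : E k) : E k := x - lastCoord x • stdVec (Fin.last (k + 1))

theorem horizontal_add_lastCoord_smul (x : E k) :
    x = horizontal x + lastCoord x • stdVec (Fin.last (k + 1)) := by
  rw [horizontal]; module

theorem horizontal_sub (x y : E k) : horizontal (x - y) = horizontal x - horizontal y := by
  have : lastCoord (x - y) = lastCoord x - lastCoord y := rfl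
  rw [horizontal, horizontal, horizontal, this]; module

theorem horizontal_smul (c : ℝ) (x : E k) : horizontal (c • x) = c • horizontal x := by
  have : lastCoord (c • x) = c * lastCoord x := rfl
  rw [horizontal, horizontal, this]; module

theorem lastCoord_horizontal (x : E k) : lastCoord (horizontal x) = 0 := by
  simp [horizontal, lastCoord, stdVec]

theorem hat_vec_horizontal (x : E k) : hat k (vec (horizontal x)) = vec (horizontal x) := by
  rw [hat_vec, reflectLast_apply, lastCoord_horizontal]; simp

/-- The component along `e_n` commutes with `e_n`, the orthogonal one anticommutes. -/
theorem vec_mul_genLast_sub_swap (x : E k) :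
    vec x * genLast k - genLast k * vec x = (2 : ℝ) • (vec (horizontal x) * genLast k) := by
  have h1 : vec (horizontal x) * genLast k + genLast k * vec (horizontal x) = 0 := by
    rw [genLast, gen, vec_mul_vec_add_swap, ← lastCoord_eq_inner, lastCoord_horizontal]; simp
  have h2 : vec x = vec (horizontal x) + lastCoord x • genLast k := by
    conv_lhs => rw [horizontal_add_lastCoord_smul x, vec_add, vec_smul]
    rfl
  have h3 : genLast k * vec (horizontal x) = -(vec (horizontal x) * genLast k) :=
    eq_neg_of_add_eq_zero_right h1
  rw [h2, add_mul, mul_add, h3, smul_mul_assoc, mul_smul_comm]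
  module

theorem P_of_hat_eq {A : Cl k} (h : hat k A = A) : P k A = A := by
  simp only [P, LinearMap.smul_apply, LinearMap.add_apply, LinearMap.id_apply,
    AlgHom.toLinearMap_apply, h]
  module

theorem P_of_hat_eq_neg {A : Cl k} (h : hat k A = -A) : P k A = 0 := by
  simp only [P, LinearMap.smul_apply, LinearMap.add_apply, LinearMap.id_apply,
    AlgHom.toLinearMap_apply, h]
  module

/-- Up to sign, right multiplication by `v' e_n` followed by `P` acts on `A` through `Q' A`. -/
theorem P_horizontal_mul (v : E k) (A : Cl k) :
    P k (vec (horizontal v) * genLast k * A) = -P k (vec v * Q' A) := by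
  obtain ⟨B, hB, C, hC, rfl⟩ := exists_decomp A
  have hv := hat_vec_horizontal v
  have hv2 : vec v = vec (horizontal v) + lastCoord v • genLast k := by
    conv_lhs => rw [horizontal_add_lastCoord_smul v, vec_add, vec_smul]
    rfl
  rw [Q', Q_decomp hB hC, mul_add, map_add, hv2, add_mul, map_add]
  -- Everything is decided by parity under `hat`: `P` kills the odd products and fixes the even
  -- ones. Both surviving terms are `v' e_n C e_n` up to sign.
  have e1 : P k (vec (horizontal v) * genLast k * B) = 0 := P_of_hat_eq_neg (by
    rw [map_mul, map_mul, hv, hat_genLast, hat_of_mem hB]; simp)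
  have e2 : P k (vec (horizontal v) * genLast k * (C * genLast k)) =
      vec (horizontal v) * genLast k * (C * genLast k) := P_of_hat_eq (by
    rw [map_mul, map_mul, map_mul, hv, hat_genLast, hat_of_mem hC]; simp)
  have e3 : P k (vec (horizontal v) * -(genLast k * C * genLast k)) =
      vec (horizontal v) * -(genLast k * C * genLast k) := P_of_hat_eq (by
    rw [map_mul, map_neg, map_mul, map_mul, hv, hat_genLast, hat_of_mem hC]; simp)
  have e4 : P k (lastCoord v • genLast k * -(genLast k * C * genLast k)) = 0 := P_of_hat_eq_neg (by
    rw [map_mul, map_smul, map_neg, map_mul, map_mul, hat_genLast, hat_of_mem hC]; simp)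
  rw [e1, e2, e3, e4]
  simp [mul_assoc]

end Clifford

/-! ### The kernel -/

section Kernel

variable {k : ℕ}

theorem hasFDerivAt_inv_norm_pow {X : Type*} [NormedAddCommGroup X] [InnerProductSpace ℝ X] (m : ℕ)
    {z : X} (hz : z ≠ 0) :
    HasFDerivAt (fun z : X => (‖z‖ ^ m)⁻¹) (-(m : ℝ) • (‖z‖ ^ (m + 2))⁻¹ • innerSL ℝ z) z := by
  have h0 : ‖z‖ ≠ 0 := norm_ne_zero_iff.2 hz
  have h1 : HasFDerivAt (fun z : X => ‖z‖) (‖z‖⁻¹ • innerSL ℝ z) z := by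
    have h2 := ((hasStrictFDerivAt_norm_sq z).hasFDerivAt).sqrt (by positivity)
    simp only [Real.sqrt_sq (norm_nonneg _)] at h2
    refine h2.congr_fderiv ?_
    ext u
    simp
    field_simp
  have h2 := ((hasDerivAt_pow m ‖z‖).inv (pow_ne_zero _ h0)).comp_hasFDerivAt z h1
  refine h2.congr_fderiv ?_
  ext u
  rcases m with _ | m
  · simp
  · simp
    field_simp
    ring

/-- The Cauchy kernel `z / ‖z‖ⁿ` of `ℝⁿ`. -/
def cauchyVec (z : E k) : E k := (‖z‖ ^ (k + 2))⁻¹ • z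

/-- The vector field `∇G(·, y) / x_n^{n-2}` for the hyperbolic Green function `G`. -/
def hypField (y x : E k) : E k :=
  (-(4 * lastCoord y) ^ k) • ((‖x - reflectLast k y‖ ^ k)⁻¹ • cauchyVec (x - y) -
    (‖x - y‖ ^ k)⁻¹ • cauchyVec (x - reflectLast k y))

theorem hasFDerivAt_cauchyVec {z : E k} (hz : z ≠ 0) :
    HasFDerivAt (cauchyVec (k := k))
      ((‖z‖ ^ (k + 2))⁻¹ • ContinuousLinearMap.id ℝ (E k) +
        (-((k + 2 : ℕ) : ℝ) • (‖z‖ ^ (k + 2 + 2))⁻¹ • innerSL ℝ z).smulRight z) z :=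
  (hasFDerivAt_inv_norm_pow (k + 2) hz).smul (hasFDerivAt_id z)

/-- Right monogenicity of the Cauchy kernel: the `-n` from `∑ e_j e_j` cancels the `+n` from `-n z z
/ ‖z‖²`. -/
theorem sum_vec_fderiv_cauchyVec_mul_gen {z : E k} (hz : z ≠ 0) :
    ∑ j, vec (fderiv ℝ cauchyVec z (stdVec j)) * gen j = 0 := by
  have h0 : ‖z‖ ≠ 0 := norm_ne_zero_iff.2 hz
  have : ∀ j, vec (fderiv ℝ cauchyVec z (stdVec j)) * gen j =
      -((‖z‖ ^ (k + 2))⁻¹ • (1 : Cl k)) +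
        (-((k + 2 : ℕ) : ℝ) * (‖z‖ ^ (k + 2 + 2))⁻¹) • (vec z * (⟪z, stdVec j⟫_ℝ • gen j)) := by
    intro j
    rw [(hasFDerivAt_cauchyVec hz).fderiv]
    simp only [_root_.add_apply, _root_.smul_apply, ContinuousLinearMap.id_apply,
      ContinuousLinearMap.smulRight_apply, innerSL_apply_apply, smul_eq_mul, vec_add, vec_smul]
    rw [add_mul, smul_mul_assoc]
    change _ • (gen j * gen j) + _ = _
    rw [gen_mul_self, smul_mul_assoc, mul_smul_comm, smul_smul]
    simp only [smul_neg, ← mul_assoc]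
  simp only [this]
  rw [Finset.sum_add_distrib, ← Finset.smul_sum, ← Finset.mul_sum, sum_inner_smul_gen, vec_mul_self]
  rw [Finset.sum_const, Finset.card_univ, Fintype.card_fin, smul_smul, ← Nat.cast_smul_eq_nsmul ℝ,
    ← neg_smul, smul_smul, ← add_smul]
  convert zero_smul ℝ (1 : Cl k) using 2
  push_cast
  field_simp
  ring

theorem lastCoord_reflectLast (y : E k) : lastCoord (reflectLast k y) = -lastCoord y := by
  rw [reflectLast_apply]
  simp [lastCoord, stdVec]
  ring

theorem sub_reflectLast (x y : E k) :
    x - reflectLast k y = (x - y) + (2 * lastCoord y) • stdVec (Fin.last (k + 1)) := by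
  rw [reflectLast_apply]; module

/-- This identity links the Euclidean kernels to the weight: it produces `x_n^k` in the gradient of
the Green function and the factor `k / x_n` in the Dirac equation of the kernel. -/
theorem norm_sub_reflectLast_sq (x y : E k) :
    ‖x - reflectLast k y‖ ^ 2 = ‖x - y‖ ^ 2 + 4 * lastCoord x * lastCoord y := by
  have : lastCoord (x - y) = lastCoord x - lastCoord y := rfl
  rw [sub_reflectLast, norm_add_sq_real, inner_smul_right, ← lastCoord_eq_inner, norm_smul, mul_pow,
    ← real_inner_self_eq_norm_sq (stdVec _), inner_stdVec_last_self, this, Real.norm_eq_abs, sq_abs]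
  ring

theorem sub_reflectLast_ne_zero {x y : E k} (hx : 0 < lastCoord x) (hy : 0 < lastCoord y) :
    x - reflectLast k y ≠ 0 := by
  intro h
  have := norm_sub_reflectLast_sq x y
  rw [h] at this
  simp at this
  nlinarith [sq_nonneg ‖x - y‖, mul_pos hx hy]

/-- Chain rule through the ratio `r = ‖a‖ / ‖b‖`, with `1 - r² = 4 x_n y_n / ‖b‖²`; the `k`-th power
of this supplies the weight. -/
theorem hasFDerivAt_green {x y : E k} (hx : 0 < lastCoord x) (hy : 0 < lastCoord y) (hxy : x ≠ y) :
    HasFDerivAt (fun z => green z y) (innerSL ℝ (lastCoord x ^ k • hypField y x)) x := by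
  have ha : x - y ≠ 0 := sub_ne_zero.2 hxy
  have hb := sub_reflectLast_ne_zero hx hy
  have ha0 : 0 < ‖x - y‖ := norm_pos_iff.2 ha
  have hb0 : 0 < ‖x - reflectLast k y‖ := norm_pos_iff.2 hb
  have hsq := norm_sub_reflectLast_sq x y
  set a := ‖x - y‖ with ha'
  set b := ‖x - reflectLast k y‖ with hb'
  have hr0 : 0 < a / b := div_pos ha0 hb0
  have hcont : ∀ t : ℝ, 0 < t → ContinuousAt (fun t : ℝ => (1 - t ^ 2) ^ k / t ^ (k + 1)) t :=
    fun t ht => ContinuousAt.div (by fun_prop) (by fun_prop) (by positivity)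
  have hG : HasDerivAt (fun r : ℝ => ∫ t in r..1, (1 - t ^ 2) ^ k / t ^ (k + 1))
      (-((1 - (a / b) ^ 2) ^ k / (a / b) ^ (k + 1))) (a / b) := by
    refine intervalIntegral.integral_hasDerivAt_left ?_ ?_ (hcont _ hr0)
    · refine ContinuousOn.intervalIntegrable fun t ht => (hcont t ?_).continuousWithinAt
      exact lt_of_lt_of_le (lt_min hr0 one_pos) ht.1
    · exact ContinuousOn.stronglyMeasurableAtFilter isOpen_Ioi
        (fun t (ht : 0 < t) => (hcont t ht).continuousWithinAt) _ hr0
  have hn : ∀ w : E k, x - w ≠ 0 → HasFDerivAt (fun z : E k => ‖z - w‖)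
      (‖x - w‖⁻¹ • innerSL ℝ (x - w)) x := by
    intro w hw
    have h1 : HasFDerivAt (fun z : E k => ‖z - w‖ ^ 2) (2 • innerSL ℝ (x - w)) x :=
      (HasFDerivAt.comp (g := fun z : E k => ‖z‖ ^ 2) x
        (hasStrictFDerivAt_norm_sq (x - w)).hasFDerivAt (hasFDerivAt_sub_const w)).congr_fderiv
        (ContinuousLinearMap.comp_id _)
    have h2 := h1.sqrt (by have := norm_ne_zero_iff.2 hw; positivity)
    simp only [Real.sqrt_sq (norm_nonneg _)] at h2
    refine h2.congr_fderiv ?_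
    ext u
    have := norm_ne_zero_iff.2 hw
    simp
    field_simp
  have hq := (hn y ha).mul ((hasDerivAt_inv hb0.ne').comp_hasFDerivAt x (hn _ hb))
  have hfin := hG.comp_hasFDerivAt x hq
  refine hfin.congr_fderiv (ContinuousLinearMap.ext fun u => ?_)
  have h1r : 1 - (a / b) ^ 2 = 4 * lastCoord x * lastCoord y / b ^ 2 := by
    field_simp
    linarith
  rw [h1r]
  simp only [hypField, cauchyVec, ← ha', ← hb', _root_.smul_apply, _root_.add_apply,
    innerSL_apply_apply, inner_smul_left, inner_sub_left, smul_eq_mul, RCLike.conj_to_real,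
    Function.comp_apply]
  generalize ⟪x - y, u⟫_ℝ = s
  generalize ⟪x - reflectLast k y, u⟫_ℝ = t
  have hb2 : (b ^ 2) ^ k = b ^ k * b ^ k := by rw [← pow_mul, two_mul, pow_add]
  rw [div_pow, div_pow, hb2, mul_pow, mul_pow]
  simp only [mul_pow]
  field_simp
  ring

end Kernel

end

noncomputable section

/-! ### First-order equation of the kernel and divergence of the flux field. -/

section KernelIdentities

variable {k : ℕ}

/-- The embedding `ℝⁿ → Cl_n` as a continuous linear map. -/
def vecL (k : ℕ) : E k →L[ℝ] Cl k := LinearMap.toContinuousLinearMap (CliffordAlgebra.ι (negForm k))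

@[simp] theorem vecL_apply (x : E k) : vecL k x = vec x := rfl

/-- The multiplication of `Cl_n` as a continuous bilinear map. -/
def mulL (k : ℕ) : Cl k →L[ℝ] Cl k →L[ℝ] Cl k :=
  LinearMap.toContinuousLinearMap
    (LinearMap.toContinuousLinearMap.toLinearMap ∘ₗ LinearMap.mul ℝ (Cl k))

@[simp] theorem mulL_apply (A B : Cl k) : mulL k A B = A * B := rfl

/-- The projection `P` as a continuous linear map. -/
def projL (k : ℕ) : Cl k →L[ℝ] Cl k := LinearMap.toContinuousLinearMap (P k)

@[simp] theorem projL_apply (A : Cl k) : projL k A = P k A := rfl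

theorem fderiv_algebraMap_comp {g : E k → ℝ} {g' : E k →L[ℝ] ℝ} {x : E k} (hg : HasFDerivAt g g' x)
    (u : E k) : fderiv ℝ (fun z => algebraMap ℝ (Cl k) (g z)) x u = g' u • 1 := by
  have := (LinearMap.toContinuousLinearMap (Algebra.linearMap ℝ (Cl k))).hasFDerivAt.comp x hg
  have h2 : HasFDerivAt (fun z => algebraMap ℝ (Cl k) (g z)) _ x := this
  rw [h2.fderiv]
  change algebraMap ℝ (Cl k) (g' u) = _
  exact Algebra.algebraMap_eq_smul_one _

theorem kernelP_eq {x y : E k} (hx : 0 < lastCoord x) (hy : 0 < lastCoord y) (hxy : x ≠ y) :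
    kernelP x y = lastCoord x ^ k • vec (hypField y x) := by
  rw [kernelP, dirac, ← vec_smul, ← sum_inner_smul_gen]
  refine Finset.sum_congr rfl fun j _ => ?_
  rw [fderiv_algebraMap_comp (hasFDerivAt_green hx hy hxy), mul_smul_comm, mul_one]
  rfl

/-- Because `∇‖z‖^{-k} = -k K z`, differentiating the scalar factors again yields Cauchy kernels,
which is what makes a commutator appear later. -/
theorem hasFDerivAt_hypField {x y : E k} (ha : x - y ≠ 0) (hb : x - reflectLast k y ≠ 0) :
    HasFDerivAt (hypField y) ((-(4 * lastCoord y) ^ k) •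
      ((‖x - reflectLast k y‖ ^ k)⁻¹ • fderiv ℝ cauchyVec (x - y) +
        (-(k : ℝ) • innerSL ℝ (cauchyVec (x - reflectLast k y))).smulRight (cauchyVec (x - y)) -
      ((‖x - y‖ ^ k)⁻¹ • fderiv ℝ cauchyVec (x - reflectLast k y) +
        (-(k : ℝ) • innerSL ℝ (cauchyVec (x - y))).smulRight
          (cauchyVec (x - reflectLast k y))))) x := by
  have hN : ∀ w : E k, x - w ≠ 0 → HasFDerivAt (fun z : E k => (‖z - w‖ ^ k)⁻¹)
      (-(k : ℝ) • innerSL ℝ (cauchyVec (x - w))) x := by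
    intro w hw
    refine (HasFDerivAt.comp (g := fun z : E k => (‖z‖ ^ k)⁻¹) x
      (hasFDerivAt_inv_norm_pow k hw) (hasFDerivAt_sub_const w)).congr_fderiv ?_
    refine ContinuousLinearMap.ext fun u => ?_
    simp [cauchyVec]
  have hK : ∀ w : E k, x - w ≠ 0 → HasFDerivAt (fun z : E k => cauchyVec (z - w))
      (fderiv ℝ cauchyVec (x - w)) x := by
    intro w hw
    exact (HasFDerivAt.comp (g := cauchyVec) x
      (hasFDerivAt_cauchyVec hw).differentiableAt.hasFDerivAt
      (hasFDerivAt_sub_const w)).congr_fderiv (ContinuousLinearMap.comp_id _)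
  exact (((hN _ hb).smul (hK _ ha)).sub ((hN _ ha).smul (hK _ hb))).const_smul (-(4 * lastCoord y) ^ k)

/-- Since `b` differs from `a` by a multiple of `e_n`, only the commutator of `a` with `e_n`
remains. -/
theorem vec_cauchyVec_commutator (x y : E k) :
    vec (cauchyVec (x - y)) * vec (cauchyVec (x - reflectLast k y)) -
      vec (cauchyVec (x - reflectLast k y)) * vec (cauchyVec (x - y)) =
    ((‖x - y‖ ^ (k + 2))⁻¹ * (‖x - reflectLast k y‖ ^ (k + 2))⁻¹ * (4 * lastCoord y)) •
      (vec (horizontal (x - y)) * genLast k) := by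
  have h2 : vec (x - reflectLast k y) = vec (x - y) + (2 * lastCoord y) • genLast k := by
    rw [sub_reflectLast, vec_add, vec_smul]; rfl
  have h3 : vec (x - y) * vec (x - reflectLast k y) - vec (x - reflectLast k y) * vec (x - y) =
      (4 * lastCoord y) • (vec (horizontal (x - y)) * genLast k) := by
    have h4 : vec (x - y) * vec (x - reflectLast k y) - vec (x - reflectLast k y) * vec (x - y) =
        (2 * lastCoord y) • (vec (x - y) * genLast k - genLast k * vec (x - y)) := by
      rw [h2, mul_add, add_mul, mul_smul_comm, smul_mul_assoc]; module
    rw [h4, vec_mul_genLast_sub_swap, smul_smul]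
    ring_nf
  rw [cauchyVec, cauchyVec, vec_smul, vec_smul, smul_mul_smul_comm, smul_mul_smul_comm,
    mul_comm (‖x - reflectLast k y‖ ^ (k + 2))⁻¹, ← smul_sub, h3, smul_smul]

/-- Reflection changes only the last coordinate, so `a` and `b` have the same horizontal part. -/
theorem horizontal_hypField (x y : E k) :
    horizontal (hypField y x) = (-(4 * lastCoord y) ^ k *
      ((‖x - reflectLast k y‖ ^ k)⁻¹ * (‖x - y‖ ^ (k + 2))⁻¹ -
        (‖x - y‖ ^ k)⁻¹ * (‖x - reflectLast k y‖ ^ (k + 2))⁻¹)) • horizontal (x - y) := by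
  have h : horizontal (x - reflectLast k y) = horizontal (x - y) := by
    rw [horizontal_sub, horizontal_sub]
    congr 1
    rw [horizontal, lastCoord_reflectLast, reflectLast_apply, horizontal]
    module
  rw [hypField, horizontal_smul, horizontal_sub, horizontal_smul, horizontal_smul, cauchyVec,
    cauchyVec, horizontal_smul, horizontal_smul, h]
  module

/-- The action of the Dirac operator on the kernel from the right. -/
theorem sum_vec_fderiv_hypField_mul_gen {x y : E k} (hx : 0 < lastCoord x) (hy : 0 < lastCoord y)
    (hxy : x ≠ y) :
    ∑ j, vec (fderiv ℝ (hypField y) x (stdVec j)) * gen j =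
      (-((k : ℝ) / lastCoord x)) • (vec (horizontal (hypField y x)) * genLast k) := by
  have ha := sub_ne_zero.2 hxy
  have hb := sub_reflectLast_ne_zero hx hy
  have hsq := norm_sub_reflectLast_sq x y
  have h1 : ∀ j, vec (fderiv ℝ (hypField y) x (stdVec j)) * gen j =
      (-(4 * lastCoord y) ^ k) •
        ((‖x - reflectLast k y‖ ^ k)⁻¹ •
            (vec (fderiv ℝ cauchyVec (x - y) (stdVec j)) * gen j) -
          (‖x - y‖ ^ k)⁻¹ •
            (vec (fderiv ℝ cauchyVec (x - reflectLast k y) (stdVec j)) * gen j) -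
          (k : ℝ) • (vec (cauchyVec (x - y)) *
            (⟪cauchyVec (x - reflectLast k y), stdVec j⟫_ℝ • gen j) -
          vec (cauchyVec (x - reflectLast k y)) *
            (⟪cauchyVec (x - y), stdVec j⟫_ℝ • gen j))) := by
    intro j
    rw [(hasFDerivAt_hypField ha hb).fderiv]
    simp only [_root_.smul_apply, _root_.add_apply, _root_.sub_apply,
      ContinuousLinearMap.smulRight_apply, innerSL_apply_apply, smul_eq_mul, vec_smul]
    have hs : ∀ u v : E k, vec (u - v) = vec u - vec v := fun u v => map_sub _ _ _
    rw [hs, vec_add, vec_add, vec_smul, vec_smul, vec_smul, vec_smul, smul_mul_assoc, sub_mul,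
      add_mul, add_mul, smul_mul_assoc, smul_mul_assoc, smul_mul_assoc, smul_mul_assoc,
      mul_smul_comm, mul_smul_comm]
    module
  simp only [h1]
  rw [← Finset.smul_sum, Finset.sum_sub_distrib, Finset.sum_sub_distrib, ← Finset.smul_sum,
    ← Finset.smul_sum, ← Finset.smul_sum, Finset.sum_sub_distrib, ← Finset.mul_sum,
    ← Finset.mul_sum, sum_inner_smul_gen, sum_inner_smul_gen, sum_vec_fderiv_cauchyVec_mul_gen ha,
    sum_vec_fderiv_cauchyVec_mul_gen hb, vec_cauchyVec_commutator, horizontal_hypField, vec_smul,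
    smul_mul_assoc, smul_zero, smul_zero, sub_zero, zero_sub, smul_neg, smul_smul, smul_smul,
    smul_smul, ← neg_smul]
  congr 1
  have ha0 : 0 < ‖x - y‖ := norm_pos_iff.2 ha
  have hb0 : 0 < ‖x - reflectLast k y‖ := norm_pos_iff.2 hb
  -- The coefficient of `γ'` contains `‖b‖² - ‖a‖² = 4 x_n y_n`; its factor `x_n` absorbs the
  -- denominator of `k / x_n`, matching the commutator coefficient.
  have h2 : (‖x - reflectLast k y‖ ^ k)⁻¹ * (‖x - y‖ ^ (k + 2))⁻¹ -
        (‖x - y‖ ^ k)⁻¹ * (‖x - reflectLast k y‖ ^ (k + 2))⁻¹ =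
      (‖x - y‖ ^ (k + 2))⁻¹ * (‖x - reflectLast k y‖ ^ (k + 2))⁻¹ *
        (4 * lastCoord x * lastCoord y) := by
    have : 4 * lastCoord x * lastCoord y = ‖x - reflectLast k y‖ ^ 2 - ‖x - y‖ ^ 2 := by linarith
    rw [this]
    field_simp
    ring
  rw [h2]
  field_simp

/-- The `Cl_n`-valued field whose flux is the boundary integrand. -/
def fieldL (k : ℕ) : E k →L[ℝ] Cl k →L[ℝ] E k →L[ℝ] Cl k :=
  LinearMap.toContinuousLinearMap (LinearMap.toContinuousLinearMap.toLinearMap ∘ₗ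
    LinearMap.mk₂ ℝ (fun (g : E k) (A : Cl k) =>
      (projL k).comp (((mulL k).flip A).comp ((mulL k (vec g)).comp (vecL k))))
      (fun g g' A => ContinuousLinearMap.ext fun u => by simp [vec_add])
      (fun c g A => ContinuousLinearMap.ext fun u => by simp [vec_smul])
      (fun g A B => ContinuousLinearMap.ext fun u => by simp)
      (fun c g A => ContinuousLinearMap.ext fun u => by simp))

@[simp] theorem fieldL_apply (g : E k) (A : Cl k) (u : E k) :
    fieldL k g A u = P k (vec g * vec u * A) := rfl

/-- The derivative of the kernel contributes `-(k / x_n) P(γ' e_n f)`, which `P_horizontal_mul`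
converts into exactly the zeroth-order term of `M`. -/
theorem divergence_fieldL {x y : E k} (hx : 0 < lastCoord x) (hy : 0 < lastCoord y) (hxy : x ≠ y)
    {f : E k → Cl k} (hf : DifferentiableAt ℝ f x) :
    divergence (fun z => fieldL k (hypField y z) (f z)) x =
      P k (vec (hypField y x) * diracHodge f x) := by
  have hγ := (hasFDerivAt_hypField (sub_ne_zero.2 hxy)
    (sub_reflectLast_ne_zero hx hy)).differentiableAt.hasFDerivAt
  have hD := (fieldL k).hasFDerivAt_of_bilinear hγ hf.hasFDerivAt
  rw [divergence_eq_sum (EuclideanSpace.basisFun (Fin (k + 2)) ℝ), hD.fderiv]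
  have h1 : ∀ j : Fin (k + 2), EuclideanSpace.basisFun (Fin (k + 2)) ℝ j = stdVec j :=
    fun j => EuclideanSpace.basisFun_apply _ _ _
  simp only [h1, _root_.add_apply, ContinuousLinearMap.precompR_apply,
    ContinuousLinearMap.precompL_apply, fieldL_apply]
  have h3 : ∀ u v, (ContinuousLinearMap.compL ℝ (E k) (Cl k) (E k →L[ℝ] Cl k) (fieldL k (hypField y x)))
      (fderiv ℝ f x) u v = P k (vec (hypField y x) * vec v * fderiv ℝ f x u) := fun u v => rfl
  simp only [h3]
  have h2 : ∀ j : Fin (k + 2), (vec (stdVec j) : Cl k) = gen j := fun j => rfl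
  simp only [h2]
  rw [Finset.sum_add_distrib, ← map_sum, ← map_sum, ← Finset.sum_mul,
    sum_vec_fderiv_hypField_mul_gen hx hy hxy, diracHodge, mul_add, map_add, smul_mul_assoc,
    map_smul, P_horizontal_mul, mul_smul_comm, map_smul, dirac, Finset.mul_sum]
  simp only [mul_assoc]
  module

theorem contDiffAt_hypField {x y : E k} (ha : x - y ≠ 0) (hb : x - reflectLast k y ≠ 0) :
    ContDiffAt ℝ 1 (hypField y) x := by
  have hN : ∀ (m : ℕ) (w : E k), x - w ≠ 0 → ContDiffAt ℝ 1 (fun z : E k => (‖z - w‖ ^ m)⁻¹) x :=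
    fun m w hw => (((contDiffAt_id.sub contDiffAt_const).norm ℝ hw).pow m).inv
      (pow_ne_zero _ (norm_ne_zero_iff.2 hw))
  have hK : ∀ w : E k, x - w ≠ 0 → ContDiffAt ℝ 1 (fun z : E k => cauchyVec (z - w)) x :=
    fun w hw => (hN _ w hw).smul (contDiffAt_id.sub contDiffAt_const)
  exact (contDiffAt_const (c := -(4 * lastCoord y) ^ k)).smul (((hN _ _ hb).smul (hK _ ha)).sub ((hN _ _ ha).smul (hK _ hb)))

end KernelIdentities

end

noncomputable section

open Module

/-! ### A radial cutoff function -/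

section Cutoff

variable {k : ℕ}

/-- A smooth function of the squared norm, equal to `1` on `s ≤ 1 / 4` and to `0` on `1 ≤ s`. -/
def cutoff (s : ℝ) : ℝ := Real.smoothTransition (4 / 3 * (1 - s))

theorem contDiff_cutoff {n : ℕ∞} : ContDiff ℝ n cutoff :=
  Real.smoothTransition.contDiff.comp (by fun_prop)

theorem cutoff_eq_one {s : ℝ} (hs : s ≤ 1 / 4) : cutoff s = 1 :=
  Real.smoothTransition.one_of_one_le (by linarith)

theorem cutoff_eq_zero {s : ℝ} (hs : 1 ≤ s) : cutoff s = 0 :=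
  Real.smoothTransition.zero_of_nonpos (by linarith)

theorem deriv_cutoff_eq_zero {s : ℝ} (hs : s < 1 / 4 ∨ 1 < s) : deriv cutoff s = 0 := by
  rcases hs with hs | hs
  · have : cutoff =ᶠ[𝓝 s] fun _ => 1 := by
      filter_upwards [gt_mem_nhds hs] with t ht using cutoff_eq_one ht.le
    rw [this.deriv_eq]; simp
  · have : cutoff =ᶠ[𝓝 s] fun _ => 0 := by
      filter_upwards [lt_mem_nhds hs] with t ht using cutoff_eq_zero ht.le
    rw [this.deriv_eq]; simp

theorem hasDerivAt_cutoff (s : ℝ) : HasDerivAt cutoff (deriv cutoff s) s :=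
  ((contDiff_cutoff (n := 1)).differentiable (by simp)).differentiableAt.hasDerivAt

theorem continuous_deriv_cutoff : Continuous (deriv cutoff) :=
  (contDiff_cutoff (n := 1)).continuous_deriv (by simp)

/-- The gradient of `z ↦ cutoff ‖z‖²`. -/
def cutoffGrad (z : E k) : E k := (2 * deriv cutoff (‖z‖ ^ 2)) • z

theorem continuous_cutoffGrad : Continuous (cutoffGrad (k := k)) :=
  ((continuous_deriv_cutoff.comp (by fun_prop)).const_mul 2).smul continuous_id

theorem cutoffGrad_eq_zero {z : E k} (hz : ‖z‖ < 1 / 2 ∨ 1 < ‖z‖) : cutoffGrad z = 0 := by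
  have : deriv cutoff (‖z‖ ^ 2) = 0 := deriv_cutoff_eq_zero <| by
    rcases hz with hz | hz
    · left; nlinarith [norm_nonneg z]
    · right; nlinarith
  simp [cutoffGrad, this]

theorem hasGradientAt_cutoff (z : E k) :
    HasGradientAt (fun z : E k => cutoff (‖z‖ ^ 2)) (cutoffGrad z) z := by
  rw [hasGradientAt_iff_hasFDerivAt]
  refine ((hasDerivAt_cutoff _).comp_hasFDerivAt z
    (hasStrictFDerivAt_norm_sq z).hasFDerivAt).congr_fderiv (ContinuousLinearMap.ext fun u => ?_)
  simp [cutoffGrad]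
  ring

/-- Both vectors are radial, so their Clifford product is a scalar and no angular averaging is
needed. -/
theorem vec_cauchyVec_mul_vec_cutoffGrad (z : E k) :
    vec (cauchyVec z) * vec (cutoffGrad z) =
      (-(2 * deriv cutoff (‖z‖ ^ 2) * (‖z‖ ^ k)⁻¹)) • (1 : Cl k) := by
  rw [cauchyVec, cutoffGrad, vec_smul, vec_smul, smul_mul_smul_comm, vec_mul_self, smul_smul]
  congr 1
  rcases eq_or_ne z 0 with rfl | hz
  · simp [deriv_cutoff_eq_zero]
  · have := norm_ne_zero_iff.2 hz
    field_simp
    ring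

/-- In polar coordinates the Jacobian `ρ^{k+1}` makes the integrand the derivative of `cutoff (ρ²)`,
which drops from `1` to `0`. -/
theorem integral_cutoff_radial :
    ∫ z : E k, 2 * deriv cutoff (‖z‖ ^ 2) * (‖z‖ ^ k)⁻¹ = -sphereArea k := by
  have h1 := integral_fun_norm_addHaar (volume : Measure (E k))
    (fun ρ : ℝ => 2 * deriv cutoff (ρ ^ 2) * (ρ ^ k)⁻¹)
  have h2 : ∫ ρ in Ioi (0 : ℝ), ρ ^ (finrank ℝ (E k) - 1) •
      (2 * deriv cutoff (ρ ^ 2) * (ρ ^ k)⁻¹) = ∫ ρ in Ioi (0 : ℝ), deriv cutoff (ρ ^ 2) * (2 * ρ) := by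
    refine setIntegral_congr_fun measurableSet_Ioi fun ρ (hρ : 0 < ρ) => ?_
    simp only [finrank_euclideanSpace, Fintype.card_fin, smul_eq_mul]
    rw [show k + 2 - 1 = k + 1 from rfl]
    field_simp
    ring
  have hcont : Continuous fun ρ : ℝ => deriv cutoff (ρ ^ 2) * (2 * ρ) :=
    (continuous_deriv_cutoff.comp (by fun_prop)).mul (by fun_prop)
  have h3 : ∫ ρ in Ioi (0 : ℝ), deriv cutoff (ρ ^ 2) * (2 * ρ) = 0 - cutoff (0 ^ 2) := by
    refine integral_Ioi_of_hasDerivAt_of_tendsto (f := fun ρ : ℝ => cutoff (ρ ^ 2)) ?_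
      (fun ρ _ => ?_) ?_ ?_
    · have : Continuous fun ρ : ℝ => cutoff (ρ ^ 2) :=
        (contDiff_cutoff (n := 1)).continuous.comp (by fun_prop)
      exact this.continuousWithinAt
    · exact (HasDerivAt.scomp (h := fun ρ : ℝ => ρ ^ 2) ρ (hasDerivAt_cutoff (ρ ^ 2))
        (hasDerivAt_pow 2 ρ)).congr_deriv (by simp [mul_comm])
    · refine IntegrableOn.mono_set (t := univ) ?_ (subset_univ _)
      refine integrableOn_of_continuousOn_of_eq_zero isClosed_univ (isCompact_Icc (a := -1) (b := 1))
        hcont.continuousOn fun ρ hρ => ?_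
      have h4 : 1 < ρ ^ 2 := by
        rw [mem_Icc, ← abs_le, not_le] at hρ
        rw [← sq_abs]; nlinarith
      rw [deriv_cutoff_eq_zero (Or.inr h4), zero_mul]
    · refine tendsto_const_nhds.congr' ?_
      filter_upwards [eventually_ge_atTop 1] with ρ hρ
      rw [cutoff_eq_zero (by nlinarith)]
  rw [h1, h2, h3, cutoff_eq_one (by norm_num), sphereArea, Measure.toSphere_real_apply_univ]
  simp

end Cutoff

/-! ### The singularity of the kernel -/

section Singularity

variable {k : ℕ}

theorem norm_cauchyVec {z : E k} : ‖cauchyVec z‖ = (‖z‖ ^ (k + 1))⁻¹ := by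
  rw [cauchyVec, norm_smul, norm_inv, norm_pow, norm_norm]
  rcases eq_or_ne z 0 with rfl | hz
  · simp
  · have := norm_ne_zero_iff.2 hz
    field_simp
    ring

/-- The reflected pole is harmless: `‖b‖ ≥ ‖a‖` and `‖b‖ ≥ y_n` throughout the half space, so the
constant does not depend on `x`. -/
theorem norm_hypField_le {x y : E k} (hx : 0 < lastCoord x) (hy : 0 < lastCoord y) (hxy : x ≠ y) :
    ‖hypField y x‖ ≤ 2 * (4 * lastCoord y) ^ k * (lastCoord y ^ k)⁻¹ * (‖x - y‖ ^ (k + 1))⁻¹ := by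
  have ha0 : 0 < ‖x - y‖ := norm_pos_iff.2 (sub_ne_zero.2 hxy)
  have hb0 : 0 < ‖x - reflectLast k y‖ := norm_pos_iff.2 (sub_reflectLast_ne_zero hx hy)
  have hsq := norm_sub_reflectLast_sq x y
  have hab : ‖x - y‖ ≤ ‖x - reflectLast k y‖ :=
    abs_le_of_sq_le_sq' (by nlinarith [mul_pos hx hy]) hb0.le |>.2
  have hyb : lastCoord y ≤ ‖x - reflectLast k y‖ := by
    have h1 : ‖lastCoord (x - reflectLast k y)‖ ≤ ‖x - reflectLast k y‖ := PiLp.norm_apply_le _ _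
    have h2 : lastCoord (x - reflectLast k y) = lastCoord x + lastCoord y := by
      have : lastCoord (x - reflectLast k y) = lastCoord x - lastCoord (reflectLast k y) := rfl
      rw [this, lastCoord_reflectLast]; ring
    rw [h2] at h1
    exact le_trans (by linarith) ((le_abs_self _).trans h1)
  rw [hypField, norm_smul, norm_neg, norm_pow, Real.norm_of_nonneg (by positivity)]
  set a := ‖x - y‖ with ha
  set b := ‖x - reflectLast k y‖ with hb
  have h1 : ‖(b ^ k)⁻¹ • cauchyVec (x - y) - (a ^ k)⁻¹ • cauchyVec (x - reflectLast k y)‖ ≤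
      (b ^ k)⁻¹ * (a ^ (k + 1))⁻¹ + (a ^ k)⁻¹ * (b ^ (k + 1))⁻¹ := by
    refine (norm_sub_le _ _).trans (le_of_eq ?_)
    rw [norm_smul, norm_smul, norm_cauchyVec, norm_cauchyVec, Real.norm_of_nonneg (by positivity),
      Real.norm_of_nonneg (by positivity)]
  have h2 : (a ^ k)⁻¹ * (b ^ (k + 1))⁻¹ ≤ (b ^ k)⁻¹ * (a ^ (k + 1))⁻¹ := by
    have : b⁻¹ ≤ a⁻¹ := by gcongr
    calc (a ^ k)⁻¹ * (b ^ (k + 1))⁻¹ = (a ^ k)⁻¹ * (b ^ k)⁻¹ * b⁻¹ := by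
          rw [pow_succ b, mul_inv, mul_assoc]
      _ ≤ (a ^ k)⁻¹ * (b ^ k)⁻¹ * a⁻¹ := by gcongr
      _ = _ := by rw [pow_succ a, mul_inv]; ring
  have h3 : (b ^ k)⁻¹ ≤ (lastCoord y ^ k)⁻¹ := by gcongr
  have h4 : (b ^ k)⁻¹ * (a ^ (k + 1))⁻¹ ≤ (lastCoord y ^ k)⁻¹ * (a ^ (k + 1))⁻¹ :=
    mul_le_mul_of_nonneg_right h3 (by positivity)
  calc (4 * lastCoord y) ^ k * _ ≤ (4 * lastCoord y) ^ k *
        ((b ^ k)⁻¹ * (a ^ (k + 1))⁻¹ + (a ^ k)⁻¹ * (b ^ (k + 1))⁻¹) := by gcongr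
    _ ≤ (4 * lastCoord y) ^ k *
        ((lastCoord y ^ k)⁻¹ * (a ^ (k + 1))⁻¹ + (lastCoord y ^ k)⁻¹ * (a ^ (k + 1))⁻¹) :=
      mul_le_mul_of_nonneg_left (add_le_add h4 (h2.trans h4)) (by positivity)
    _ = _ := by ring

/-- The Cauchy kernel is homogeneous of degree `-(k + 1)`, the second term of the field retains an
extra factor `r`, and `‖b‖ → 2 y_n` gives `(4 y_n / 2 y_n)^k = 2^k`. -/
theorem tendsto_smul_hypField {y : E k} (hy : 0 < lastCoord y) {z : E k} (hz : z ≠ 0) :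
    Tendsto (fun r : ℝ => r ^ (k + 1) • hypField y (y + r • z)) (𝓝[>] 0)
      (𝓝 ((-2 ^ k : ℝ) • cauchyVec z)) := by
  set e : E k := (2 * lastCoord y) • stdVec (Fin.last (k + 1)) with he
  have hen : ‖e‖ = 2 * lastCoord y := by
    rw [he, norm_smul, Real.norm_of_nonneg (by positivity)]
    simp [stdVec]
  have he0 : e ≠ 0 := norm_ne_zero_iff.1 (by rw [hen]; positivity)
  have hz0 := norm_ne_zero_iff.2 hz
  have heq : ∀ r : ℝ, 0 < r → (-(4 * lastCoord y) ^ k) • ((‖r • z + e‖ ^ k)⁻¹ • cauchyVec z -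
      (r * (‖z‖ ^ k)⁻¹) • cauchyVec (r • z + e)) = r ^ (k + 1) • hypField y (y + r • z) := by
    intro r hr
    have e1 : y + r • z - y = r • z := by abel
    have e2 : y + r • z - reflectLast k y = r • z + e := by rw [sub_reflectLast, e1]
    have e3 : cauchyVec (r • z) = (r ^ (k + 1))⁻¹ • cauchyVec z := by
      rw [cauchyVec, cauchyVec, norm_smul, Real.norm_of_nonneg hr.le, smul_smul, smul_smul]
      congr 1
      field_simp
      ring
    rw [hypField, e1, e2, e3, norm_smul, Real.norm_of_nonneg hr.le, smul_comm (r ^ (k + 1))]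
    congr 1
    rw [smul_sub, smul_smul, smul_smul, smul_smul]
    congr 2
    · field_simp
    · field_simp
      ring
  have hlim : Tendsto (fun r : ℝ => (-(4 * lastCoord y) ^ k) •
      ((‖r • z + e‖ ^ k)⁻¹ • cauchyVec z - (r * (‖z‖ ^ k)⁻¹) • cauchyVec (r • z + e))) (𝓝[>] 0)
      (𝓝 ((-(4 * lastCoord y) ^ k) • ((‖(0 : ℝ) • z + e‖ ^ k)⁻¹ • cauchyVec z -
        ((0 : ℝ) * (‖z‖ ^ k)⁻¹) • cauchyVec ((0 : ℝ) • z + e)))) := by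
    have h1 : ContinuousAt (fun r : ℝ => (‖r • z + e‖ ^ k)⁻¹) 0 :=
      by
      have : Continuous fun r : ℝ => ‖r • z + e‖ ^ k := by fun_prop
      refine this.continuousAt.inv₀ ?_
      rw [zero_smul, zero_add]
      exact pow_ne_zero _ (norm_ne_zero_iff.2 he0)
    have h2 : ContinuousAt (fun r : ℝ => cauchyVec (r • z + e)) 0 := by
      have : ContinuousAt (cauchyVec (k := k)) ((0 : ℝ) • z + e) :=
        (hasFDerivAt_cauchyVec (by simpa using he0)).continuousAt
      exact ContinuousAt.comp (f := fun r : ℝ => r • z + e) this (by fun_prop)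
    have h3 : ContinuousAt (fun r : ℝ => r * (‖z‖ ^ k)⁻¹) 0 := by fun_prop
    have h4 := ((h1.smul (continuousAt_const (y := cauchyVec z))).sub (h3.smul h2)).const_smul
      (-(4 * lastCoord y) ^ k)
    exact h4.tendsto.mono_left nhdsWithin_le_nhds
  have hval : (-(4 * lastCoord y) ^ k) • ((‖(0 : ℝ) • z + e‖ ^ k)⁻¹ • cauchyVec z -
        ((0 : ℝ) * (‖z‖ ^ k)⁻¹) • cauchyVec ((0 : ℝ) • z + e)) = (-2 ^ k : ℝ) • cauchyVec z := by
    rw [zero_smul, zero_add, zero_mul, zero_smul, sub_zero, hen, smul_smul]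
    congr 1
    rw [mul_pow, mul_pow, show (4 : ℝ) = 2 * 2 by norm_num, mul_pow]
    field_simp
  rw [hval] at hlim
  refine hlim.congr' ?_
  filter_upwards [self_mem_nhdsWithin] with r hr using heq r hr

/-- In polar coordinates the Jacobian `ρ^{k+1}` cancels the singularity exactly. -/
theorem integrableOn_inv_norm_pow (y : E k) (δ : ℝ) :
    IntegrableOn (fun x : E k => (‖x - y‖ ^ (k + 1))⁻¹) (Metric.closedBall y δ) := by
  have h1 : Integrable (fun x : E k => (Iic δ).indicator (fun ρ : ℝ => (ρ ^ (k + 1))⁻¹) ‖x‖) := by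
    rw [integrable_fun_norm_addHaar volume]
    have h2 : IntegrableOn (fun ρ : ℝ => (1 : ℝ)) (Ioc 0 δ) :=
      integrableOn_const (by simp)
    have h3 : IntegrableOn ((Iic δ).indicator fun _ : ℝ => (1 : ℝ)) (Ioi 0) := by
      rw [IntegrableOn, integrable_indicator_iff measurableSet_Iic, IntegrableOn,
        Measure.restrict_restrict measurableSet_Iic, inter_comm, Ioi_inter_Iic]
      exact h2
    refine h3.congr_fun (fun ρ (hρ : 0 < ρ) => ?_) measurableSet_Ioi
    by_cases h : ρ ∈ Iic δ
    · rw [indicator_of_mem h, indicator_of_mem h, finrank_euclideanSpace, Fintype.card_fin,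
        smul_eq_mul, show k + 2 - 1 = k + 1 from rfl, mul_inv_cancel₀ (by positivity)]
    · rw [indicator_of_notMem h, indicator_of_notMem h, smul_zero]
  have h2 := h1.comp_sub_right y
  rw [← integrable_indicator_iff Metric.isClosed_closedBall.measurableSet]
  refine h2.congr (Eventually.of_forall fun x => ?_)
  by_cases h : x ∈ Metric.closedBall y δ
  · have h' : ‖x - y‖ ∈ Iic δ := by simpa [dist_eq_norm] using h
    simp only [indicator_of_mem h, indicator_of_mem h']
  · have h' : ‖x - y‖ ∉ Iic δ := by simpa [dist_eq_norm] using h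
    simp only [indicator_of_notMem h, indicator_of_notMem h']

end Singularity

end

noncomputable section

/-! ### Removing the singularity and passing to the limit. -/

section Representation

variable {k : ℕ} {U : Set (E k)} {f : E k → Cl k} {y : E k}

theorem measurable_hypField (y : E k) : Measurable (hypField y) := by
  unfold hypField cauchyVec
  fun_prop

theorem continuousOn_diracHodge (hU : IsOpen U) (hupper : U ⊆ upperHalfSpace k)
    (hf : ContDiffOn ℝ 1 f U) : ContinuousOn (diracHodge f) U := by
  have h1 : ContinuousOn (fderiv ℝ f) U := hf.continuousOn_fderiv_of_isOpen hU le_rfl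
  have hlast : Continuous (lastCoord (k := k)) := by unfold lastCoord; fun_prop
  refine ContinuousOn.add (continuousOn_finsetSum _ fun j _ => ?_) (ContinuousOn.fun_smul ?_ ?_)
  · exact (mulL k (gen j)).continuous.comp_continuousOn (h1.clm_apply continuousOn_const)
  · exact continuousOn_const.div hlast.continuousOn fun x hx => (hupper hx).ne'
  · have h2 : ContinuousOn (fun x => -((mulL k).flip (genLast k)) (mulL k (genLast k)
        (LinearMap.toContinuousLinearMap (Q k) (f x)))) U := by
      have := hf.continuousOn
      fun_prop
    exact h2

/-- The volume integrand of the representation formula is integrable across the singularity. -/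
theorem integrableOn_vec_hypField_mul (hU : IsOpen U) (hupper : U ⊆ upperHalfSpace k) {g : E k → Cl k}
    (hg : ContinuousOn g U) (hgi : IntegrableOn g U) (hy : y ∈ U) :
    IntegrableOn (fun x => vec (hypField y x) * g x) U := by
  obtain ⟨δ, hδ, hδU⟩ := Metric.nhds_basis_closedBall.mem_iff.1 (hU.mem_nhds hy)
  obtain ⟨M, hM⟩ := (isCompact_closedBall y δ).exists_bound_of_continuousOn (hg.mono hδU)
  let B : E k →L[ℝ] Cl k →L[ℝ] Cl k := (mulL k).comp (vecL k)
  have hy' : 0 < lastCoord y := hupper hy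
  set C := 2 * (4 * lastCoord y) ^ k * (lastCoord y ^ k)⁻¹ with hC
  have hC0 : 0 ≤ C := by positivity
  have hM0 : 0 ≤ M := (norm_nonneg _).trans (hM y (Metric.mem_closedBall_self hδ.le))
  have hmeas : AEStronglyMeasurable (fun x => B (hypField y x) (g x)) (volume.restrict U) :=
    B.aestronglyMeasurable_comp₂ (measurable_hypField y).aestronglyMeasurable
      hgi.aestronglyMeasurable
  -- Near `y` the function `g` is bounded and the kernel integrable; away from `y` the kernel is
  -- bounded and `g` integrable. The sum of the two bounds dominates everywhere.
  have hb1 : IntegrableOn ((Metric.closedBall y δ).indicator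
      fun x : E k => ‖B‖ * C * M * (‖x - y‖ ^ (k + 1))⁻¹) U :=
    (IntegrableOn.integrable_indicator ((integrableOn_inv_norm_pow y δ).const_mul (‖B‖ * C * M))
      Metric.isClosed_closedBall.measurableSet).integrableOn
  have hb2 : IntegrableOn (fun x => ‖B‖ * C * (δ ^ (k + 1))⁻¹ * ‖g x‖) U := hgi.norm.const_mul _
  refine (hb1.add hb2).mono' hmeas ?_
  have hne : ∀ᵐ x ∂volume.restrict U, x ≠ y :=
    ae_restrict_of_ae (compl_mem_ae_iff.2 (measure_singleton y))
  filter_upwards [hne, ae_restrict_mem hU.measurableSet] with x hxy hx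
  have h1 := norm_hypField_le (hupper hx) hy' hxy
  rw [← hC] at h1
  refine (B.le_opNorm₂ _ _).trans ?_
  by_cases h : x ∈ Metric.closedBall y δ
  · rw [Pi.add_apply, indicator_of_mem h]
    refine le_add_of_le_of_nonneg ?_ (by positivity)
    calc ‖B‖ * ‖hypField y x‖ * ‖g x‖ ≤ ‖B‖ * (C * (‖x - y‖ ^ (k + 1))⁻¹) * M := by
          gcongr; exact hM x h
      _ = _ := by ring
  · rw [Pi.add_apply, indicator_of_notMem h, zero_add]
    rw [Metric.mem_closedBall, dist_eq_norm, not_le] at h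
    calc ‖B‖ * ‖hypField y x‖ * ‖g x‖ ≤ ‖B‖ * (C * (δ ^ (k + 1))⁻¹) * ‖g x‖ := by
          gcongr
          exact h1.trans (by gcongr)
      _ = _ := by ring

/-- The function vanishing near `y` and equal to `1` at distance at least `r` from `y`. -/
def puncture (y : E k) (r : ℝ) (x : E k) : ℝ := 1 - cutoff (‖r⁻¹ • (x - y)‖ ^ 2)

theorem norm_inv_smul_sub {r : ℝ} (hr : 0 < r) (x : E k) : ‖r⁻¹ • (x - y)‖ = ‖x - y‖ / r := by
  rw [norm_smul, norm_inv, Real.norm_of_nonneg hr.le, inv_mul_eq_div]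

theorem puncture_eq_zero {r : ℝ} (hr : 0 < r) {x : E k} (hx : x ∈ Metric.ball y (r / 2)) :
    puncture y r x = 0 := by
  rw [Metric.mem_ball, dist_eq_norm] at hx
  have : ‖r⁻¹ • (x - y)‖ ≤ 1 / 2 := by
    rw [norm_inv_smul_sub hr, div_le_iff₀ hr]; linarith
  rw [puncture, cutoff_eq_one (by nlinarith [norm_nonneg (r⁻¹ • (x - y))]), sub_self]

theorem puncture_eq_one {r : ℝ} (hr : 0 < r) {x : E k} (hx : x ∉ Metric.ball y r) :
    puncture y r x = 1 := by
  rw [Metric.mem_ball, dist_eq_norm, not_lt] at hx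
  have : 1 ≤ ‖r⁻¹ • (x - y)‖ := by
    rw [norm_inv_smul_sub hr, le_div_iff₀ hr]; linarith
  rw [puncture, cutoff_eq_zero (by nlinarith), sub_zero]

theorem norm_puncture_le (y : E k) (r : ℝ) (x : E k) : ‖puncture y r x‖ ≤ 1 := by
  have h0 : 0 ≤ cutoff (‖r⁻¹ • (x - y)‖ ^ 2) := Real.smoothTransition.nonneg _
  have h1 : cutoff (‖r⁻¹ • (x - y)‖ ^ 2) ≤ 1 := Real.smoothTransition.le_one _
  rw [puncture, Real.norm_of_nonneg (by linarith)]
  linarith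

theorem contDiff_puncture (y : E k) (r : ℝ) : ContDiff ℝ 1 (puncture y r) :=
  contDiff_const.sub ((contDiff_cutoff (n := 1)).comp
    ((contDiff_norm_sq ℝ).comp ((contDiff_id.sub contDiff_const).const_smul r⁻¹)))

theorem gradient_puncture (y : E k) (r : ℝ) (x : E k) :
    gradient (puncture y r) x = -(r⁻¹ • cutoffGrad (r⁻¹ • (x - y))) := by
  refine HasGradientAt.gradient ?_
  have h1 : HasFDerivAt (fun x : E k => r⁻¹ • (x - y)) (r⁻¹ • ContinuousLinearMap.id ℝ (E k)) x :=
    (hasFDerivAt_sub_const y).const_smul r⁻¹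
  have h2 := ((hasGradientAt_cutoff (r⁻¹ • (x - y))).hasFDerivAt.comp x h1).const_sub 1
  rw [hasGradientAt_iff_hasFDerivAt]
  refine h2.congr_fderiv (ContinuousLinearMap.ext fun u => ?_)
  simp

/-- The divergence theorem for the punctured kernel field. -/
theorem setIntegral_punctured (hU : IsOpen U) (hbdd : Bornology.IsBounded U)
    (hupper : U ⊆ upperHalfSpace k) (hfrontier : frontier U ⊆ upperHalfSpace k)
    (hC1 : HasC1Boundary U) (hf : ContDiffOn ℝ 1 f U) (hcont : ContinuousOn f (closure U))
    (hy : y ∈ U) {r : ℝ} (hr : 0 < r) (hrU : Metric.closedBall y r ⊆ U)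
    (hint : IntegrableOn (fun x => P k (vec (hypField y x) * diracHodge f x)) U) :
    ∫ x in frontier U, fieldL k (hypField y x) (f x) (outerNormal U x)
        ∂(Measure.euclideanHausdorffMeasure (k + 1)) =
      (∫ x in U, puncture y r x • P k (vec (hypField y x) * diracHodge f x)) -
        ∫ x in U, fieldL k (hypField y x) (f x) (r⁻¹ • cutoffGrad (r⁻¹ • (x - y))) := by
  have hupper' : closure U ⊆ upperHalfSpace k := by
    rw [closure_eq_self_union_frontier]; exact union_subset hupper hfrontier
  have hy' : 0 < lastCoord y := hupper hy
  set F : E k → E k →L[ℝ] Cl k := fun x => fieldL k (hypField y x) (f x) with hF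
  have hγ : ∀ x ∈ closure U, x ≠ y → ContDiffAt ℝ 1 (hypField y) x := fun x hx hxy =>
    contDiffAt_hypField (sub_ne_zero.2 hxy) (sub_reflectLast_ne_zero (hupper' hx) hy')
  have hFd : ∀ x ∈ U, x ≠ y → ContDiffAt ℝ 1 F x := fun x hx hxy =>
    (contDiffAt_const.clm_apply (hγ x (subset_closure hx) hxy)).clm_apply
      (hf.contDiffAt (hU.mem_nhds hx))
  have hFc : ∀ x ∈ closure U, x ≠ y → ContinuousWithinAt F (closure U) x := fun x hx hxy =>
    (continuousWithinAt_const.clm_apply (hγ x hx hxy).continuousAt.continuousWithinAt).clm_apply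
      (hcont x hx)
  have hnear : ∀ᶠ x in 𝓝 y, x ∈ Metric.ball y (r / 2) := Metric.ball_mem_nhds y (by positivity)
  have hχ := contDiff_puncture y r
  set G : E k → E k →L[ℝ] Cl k := fun x => puncture y r x • F x with hG
  -- The cutoff vanishes on a whole ball around `y`, so the arbitrary value of the kernel at `y`
  -- does not matter and `G` is `C¹` on all of `U`.
  have hG0 : G =ᶠ[𝓝 y] fun _ => 0 := hnear.mono fun x hx => by
    simp only [hG, puncture_eq_zero hr hx, zero_smul]
  have hGd : ContDiffOn ℝ 1 G U := fun x hx => by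
    rcases eq_or_ne x y with rfl | hxy
    · exact (contDiffAt_const.congr_of_eventuallyEq hG0).contDiffWithinAt
    · exact (hχ.contDiffAt.smul (hFd x hx hxy)).contDiffWithinAt
  have hGc : ContinuousOn G (closure U) := fun x hx => by
    rcases eq_or_ne x y with rfl | hxy
    · exact (continuousAt_const.congr hG0.symm).continuousWithinAt
    · exact hχ.continuous.continuousWithinAt.smul (hFc x hx hxy)
  set c : E k → E k := fun x => r⁻¹ • cutoffGrad (r⁻¹ • (x - y)) with hc
  have hcc : Continuous c := (continuous_cutoffGrad.comp (by fun_prop)).const_smul r⁻¹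
  have hc0 : ∀ x, ‖x - y‖ < r / 2 ∨ r < ‖x - y‖ → c x = 0 := fun x hx => by
    simp only [hc]
    rw [cutoffGrad_eq_zero, smul_zero]
    rw [norm_inv_smul_sub hr, div_lt_iff₀ hr, lt_div_iff₀ hr]
    exact hx.imp (fun h => by linarith) fun h => by linarith
  have hdiv : ∀ x ∈ U, x ≠ y → divergence G x =
      puncture y r x • P k (vec (hypField y x) * diracHodge f x) - F x (c x) := fun x hx hxy => by
    rw [hG, divergence_smul (hχ.differentiable one_ne_zero).differentiableAt
      ((hFd x hx hxy).differentiableAt one_ne_zero), gradient_puncture, map_neg, ← sub_eq_add_neg,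
      hF, divergence_fieldL (hupper hx) hy' hxy
        ((hf.contDiffAt (hU.mem_nhds hx)).differentiableAt one_ne_zero)]
  have hi1 : IntegrableOn
      (fun x => puncture y r x • P k (vec (hypField y x) * diracHodge f x)) U :=
    hint.bdd_smul 1 hχ.continuous.aestronglyMeasurable
      (Eventually.of_forall (norm_puncture_le y r))
  have hi2 : IntegrableOn (fun x => F x (c x)) U := by
    refine IntegrableOn.of_forall_sdiff_eq_zero (s := Metric.closedBall y r) ?_ hU.measurableSet
      fun x hx => ?_
    · refine ContinuousOn.integrableOn_compact (isCompact_closedBall y r) fun x hx => ?_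
      refine ContinuousAt.continuousWithinAt ?_
      rcases eq_or_ne x y with rfl | hxy
      · refine continuousAt_const.congr (f := fun _ => 0) (hnear.mono fun z hz => ?_)
        dsimp only
        rw [hc0 z (Or.inl (by simpa [dist_eq_norm] using hz)), map_zero]
      · exact (hFd x (hrU hx) hxy).continuousAt.clm_apply hcc.continuousAt
    · rw [hc0 x (Or.inr (by simpa [dist_eq_norm] using hx.2)), map_zero]
  have hne : ∀ᵐ x ∂volume.restrict U, x ≠ y :=
    ae_restrict_of_ae (compl_mem_ae_iff.2 (measure_singleton y))
  have hae : divergence G =ᵐ[volume.restrict U] fun x =>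
      puncture y r x • P k (vec (hypField y x) * diracHodge f x) - F x (c x) := by
    filter_upwards [hne, ae_restrict_mem hU.measurableSet] with x hxy hx using hdiv x hx hxy
  have hmain := setIntegral_divergence hU hbdd hC1 hGd hGc ((hi1.sub hi2).congr hae.symm)
  rw [integral_congr_ae hae, integral_sub hi1 hi2] at hmain
  rw [hmain]
  refine setIntegral_congr_fun isClosed_frontier.measurableSet fun x hx => ?_
  have hx' : x ∉ Metric.ball y r := fun h => by
    have : x ∈ U := hrU (Metric.ball_subset_closedBall h)
    rw [hU.frontier_eq] at hx
    exact hx.2 this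
  simp only [hG, puncture_eq_one hr hx', one_smul, hF]

/-- Substitution `x = y + r z`: the Jacobian `r^{k+2}` and the `r⁻¹` from the gradient leave
`r^{k+1}`, the scaling of the kernel. -/
theorem setIntegral_fieldL_cutoffGrad {r : ℝ} (hr : 0 < r) (hrU : Metric.closedBall y r ⊆ U) :
    ∫ x in U, fieldL k (hypField y x) (f x) (r⁻¹ • cutoffGrad (r⁻¹ • (x - y))) =
      ∫ z in Metric.closedBall (0 : E k) 1,
        fieldL k (r ^ (k + 1) • hypField y (y + r • z)) (f (y + r • z)) (cutoffGrad z) := by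
  rw [setIntegral_eq_integral_of_forall_compl_eq_zero fun x hx => ?_,
    setIntegral_eq_integral_of_forall_compl_eq_zero fun z hz => ?_]
  · set g : E k → Cl k := fun x =>
      fieldL k (hypField y x) (f x) (r⁻¹ • cutoffGrad (r⁻¹ • (x - y))) with hg
    rw [← integral_add_left_eq_self g y]
    have h1 := Measure.integral_comp_smul (volume : Measure (E k)) (fun w => g (y + w)) r
    rw [abs_of_nonneg (by positivity), eq_inv_smul_iff₀ (by positivity), finrank_euclideanSpace,
      Fintype.card_fin, ← integral_smul] at h1
    rw [← h1]
    refine integral_congr_ae (Eventually.of_forall fun z => ?_)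
    simp only [hg, add_sub_cancel_left, inv_smul_smul₀ hr.ne', map_smul, _root_.smul_apply,
      smul_smul]
    congr 1
    field_simp
    ring
  · rw [cutoffGrad_eq_zero (Or.inr (by simpa using hz)), map_zero]
  · have h : x ∉ Metric.closedBall y r := fun h => hx (hrU h)
    rw [Metric.mem_closedBall, dist_eq_norm, not_le] at h
    rw [cutoffGrad_eq_zero (Or.inr (by rwa [norm_inv_smul_sub hr, one_lt_div hr])), smul_zero,
      map_zero]

theorem integral_fieldL_cauchyVec_cutoffGrad (A : Cl k) :
    ∫ z, fieldL k ((-2 ^ k : ℝ) • cauchyVec z) A (cutoffGrad z) =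
      -((2 ^ k * sphereArea k) • P k A) := by
  have h : ∀ z : E k, fieldL k ((-2 ^ k : ℝ) • cauchyVec z) A (cutoffGrad z) =
      (2 * deriv cutoff (‖z‖ ^ 2) * (‖z‖ ^ k)⁻¹) • ((2 : ℝ) ^ k • P k A) := fun z => by
    rw [fieldL_apply, vec_smul, smul_mul_assoc, vec_cauchyVec_mul_vec_cutoffGrad, smul_smul,
      smul_mul_assoc, one_mul, map_smul, smul_smul]
    congr 1
    ring
  simp only [h]
  rw [integral_smul_const, integral_cutoff_radial, smul_smul, ← neg_smul]
  congr 1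
  ring

/-- Operator norms of the bilinear product are used in place of submultiplicativity of the
coefficient norm. -/
theorem exists_norm_fieldL_apply_le (k : ℕ) :
    ∃ K : ℝ, 0 ≤ K ∧ ∀ g A u, ‖fieldL k g A u‖ ≤ K * ‖g‖ * ‖A‖ * ‖u‖ := by
  let B : E k →L[ℝ] Cl k →L[ℝ] Cl k := (mulL k).comp (vecL k)
  refine ⟨‖projL k‖ * ‖B‖ * ‖B‖, by positivity, fun g A u => ?_⟩
  have h : fieldL k g A u = projL k (B g (B u A)) := by
    rw [fieldL_apply, mul_assoc]; rfl
  calc ‖fieldL k g A u‖ ≤ ‖projL k‖ * ‖B g (B u A)‖ := by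
        rw [h]; exact (projL k).le_opNorm _
    _ ≤ ‖projL k‖ * (‖B‖ * ‖g‖ * (‖B‖ * ‖u‖ * ‖A‖)) := by
        gcongr
        refine (B.le_opNorm₂ _ _).trans ?_
        gcongr
        exact B.le_opNorm₂ _ _
    _ = _ := by ring

theorem tendsto_integral_fieldL_cutoffGrad (hU : IsOpen U) (hupper : U ⊆ upperHalfSpace k)
    (hf : ContinuousOn f U) (hy : y ∈ U) :
    Tendsto (fun r : ℝ => ∫ z in Metric.closedBall (0 : E k) 1,
        fieldL k (r ^ (k + 1) • hypField y (y + r • z)) (f (y + r • z)) (cutoffGrad z))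
      (𝓝[>] 0) (𝓝 (-((2 ^ k * sphereArea k) • P k (f y)))) := by
  obtain ⟨δ, hδ, hδU⟩ := Metric.nhds_basis_closedBall.mem_iff.1 (hU.mem_nhds hy)
  obtain ⟨M, hM⟩ := (isCompact_closedBall y δ).exists_bound_of_continuousOn (hf.mono hδU)
  have hy' : 0 < lastCoord y := hupper hy
  have hM0 : 0 ≤ M := (norm_nonneg _).trans (hM y (Metric.mem_closedBall_self hδ.le))
  set C := 2 * (4 * lastCoord y) ^ k * (lastCoord y ^ k)⁻¹ with hC
  have hC0 : 0 ≤ C := by positivity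
  obtain ⟨K, hK0, hK⟩ := exists_norm_fieldL_apply_le k
  have hmem : ∀ r : ℝ, 0 < r → r < δ → ∀ z ∈ Metric.closedBall (0 : E k) 1,
      y + r • z ∈ Metric.closedBall y δ := fun r hr hrδ z hz => by
    rw [mem_closedBall_zero_iff] at hz
    rw [Metric.mem_closedBall, dist_eq_norm, add_sub_cancel_left, norm_smul,
      Real.norm_of_nonneg hr.le]
    nlinarith
  have hsmall : ∀ᶠ r : ℝ in 𝓝[>] 0, 0 < r ∧ r < δ := Ioo_mem_nhdsGT hδ
  have hgrad : IntegrableOn (fun z : E k => K * (C * 2 ^ (k + 1)) * M * ‖cutoffGrad z‖)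
      (Metric.closedBall 0 1) :=
    ContinuousOn.integrableOn_compact (isCompact_closedBall _ _)
      (continuous_const.mul continuous_cutoffGrad.norm).continuousOn
  rw [← integral_fieldL_cauchyVec_cutoffGrad,
    ← setIntegral_eq_integral_of_forall_compl_eq_zero (s := Metric.closedBall (0 : E k) 1)
      fun z hz => by rw [cutoffGrad_eq_zero (Or.inr (by simpa using hz)), map_zero]]
  refine tendsto_integral_filter_of_dominated_convergence _ ?_ ?_ hgrad ?_
  · filter_upwards [hsmall] with r hr
    have h1 : ContinuousOn (fun z : E k => f (y + r • z)) (Metric.closedBall 0 1) :=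
      hf.comp (by fun_prop) fun z hz => hδU (hmem r hr.1 hr.2 z hz)
    have h3 : Measurable fun z : E k => y + r • z := by fun_prop
    have h2 : Measurable fun z : E k => r ^ (k + 1) • hypField y (y + r • z) :=
      ((measurable_hypField y).comp h3).fun_const_smul _
    exact (ContinuousLinearMap.id ℝ (E k →L[ℝ] Cl k)).aestronglyMeasurable_comp₂
      ((fieldL k).aestronglyMeasurable_comp₂ h2.aestronglyMeasurable
        (h1.aestronglyMeasurable Metric.isClosed_closedBall.measurableSet))
      continuous_cutoffGrad.aestronglyMeasurable
  · filter_upwards [hsmall] with r hr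
    filter_upwards [ae_restrict_mem Metric.isClosed_closedBall.measurableSet] with z hz
    -- The cutoff gradient vanishes for `‖z‖ < 1 / 2`; elsewhere `‖z‖⁻¹ ≤ 2`, so the rescaled kernel
    -- is bounded independently of `r`.
    by_cases hz2 : ‖z‖ < 1 / 2
    · rw [cutoffGrad_eq_zero (Or.inl hz2), map_zero, norm_zero, norm_zero, mul_zero]
    · rw [not_lt] at hz2
      have hz0 : 0 < ‖z‖ := by linarith
      have hzB := hmem r hr.1 hr.2 z hz
      have hb := norm_hypField_le (hupper (hδU hzB)) hy' (x := y + r • z) (fun h => by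
        have : r • z = 0 := by simpa using h
        rw [smul_eq_zero] at this
        exact this.elim hr.1.ne' (norm_pos_iff.1 hz0))
      rw [← hC, add_sub_cancel_left, norm_smul, Real.norm_of_nonneg hr.1.le] at hb
      have hb' : ‖r ^ (k + 1) • hypField y (y + r • z)‖ ≤ C * 2 ^ (k + 1) := by
        have hr0 := hr.1
        rw [norm_smul, Real.norm_of_nonneg (by positivity)]
        calc r ^ (k + 1) * ‖hypField y (y + r • z)‖
            ≤ r ^ (k + 1) * (C * ((r * ‖z‖) ^ (k + 1))⁻¹) := by gcongr
          _ = C * (‖z‖⁻¹) ^ (k + 1) := by rw [mul_pow, inv_pow]; field_simp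
          _ ≤ C * 2 ^ (k + 1) := by
            gcongr
            rw [inv_le_comm₀ hz0 (by norm_num)]; linarith
      refine (hK _ _ _).trans ?_
      gcongr
      exact hM _ hzB
  · refine Eventually.of_forall fun z => ?_
    rcases eq_or_ne z 0 with rfl | hz
    · simp only [cutoffGrad_eq_zero (z := (0 : E k)) (Or.inl (by norm_num)), map_zero]
      exact tendsto_const_nhds
    · have h1 : Tendsto (fun r : ℝ => f (y + r • z)) (𝓝[>] 0) (𝓝 (f y)) := by
        have h2 : Tendsto (fun r : ℝ => y + r • z) (𝓝[>] 0) (𝓝 y) := by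
          have : Continuous fun r : ℝ => y + r • z := by fun_prop
          simpa using (this.tendsto 0).mono_left nhdsWithin_le_nhds
        exact (hf.continuousAt (hU.mem_nhds hy)).tendsto.comp h2
      have h3 : Tendsto (fun r : ℝ => fieldL k (r ^ (k + 1) • hypField y (y + r • z))) (𝓝[>] 0)
          (𝓝 (fieldL k ((-2 ^ k : ℝ) • cauchyVec z))) :=
        ((fieldL k).continuous.tendsto _).comp (tendsto_smul_hypField hy' hz)
      have h4 := (isBoundedBilinearMap_apply (𝕜 := ℝ) (E := Cl k) (F := E k →L[ℝ] Cl k)).continuous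
      have h5 := (h4.tendsto _).comp (h3.prodMk_nhds h1)
      exact ((ContinuousLinearMap.apply ℝ (Cl k) (cutoffGrad z)).continuous.tendsto _).comp h5

theorem tendsto_setIntegral_puncture_smul {g : E k → Cl k} (hg : IntegrableOn g U) :
    Tendsto (fun r : ℝ => ∫ x in U, puncture y r x • g x) (𝓝[>] 0) (𝓝 (∫ x in U, g x)) := by
  refine tendsto_integral_filter_of_dominated_convergence (fun x => ‖g x‖) ?_ ?_ hg.norm ?_
  · exact Eventually.of_forall fun r =>
      (contDiff_puncture y r).continuous.aestronglyMeasurable.smul hg.aestronglyMeasurable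
  · refine Eventually.of_forall fun r => Eventually.of_forall fun x => ?_
    rw [norm_smul]
    exact mul_le_of_le_one_left (norm_nonneg _) (norm_puncture_le y r x)
  · have hne : ∀ᵐ x ∂volume.restrict U, x ≠ y :=
      ae_restrict_of_ae (compl_mem_ae_iff.2 (measure_singleton y))
    filter_upwards [hne] with x hxy
    refine tendsto_const_nhds.congr' ?_
    filter_upwards [Ioo_mem_nhdsGT (norm_pos_iff.2 (sub_ne_zero.2 hxy))] with r hr
    rw [puncture_eq_one hr.1 (by simpa [dist_eq_norm] using hr.2.le), one_smul]

theorem sphereArea_pos (k : ℕ) : 0 < sphereArea k := by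
  rw [sphereArea, Measure.toSphere_real_apply_univ]
  have h : 0 < (volume : Measure (E k)).real (Metric.ball 0 1) :=
    ENNReal.toReal_pos (Metric.measure_ball_pos _ _ one_pos).ne' measure_ball_lt_top.ne
  have : 0 < Module.finrank ℝ (E k) := Module.finrank_pos
  positivity

/-- The Borel–Pompeiu formula for the field `fieldL`. -/
theorem setIntegral_frontier_fieldL (hU : IsOpen U) (hbdd : Bornology.IsBounded U)
    (hupper : U ⊆ upperHalfSpace k) (hfrontier : frontier U ⊆ upperHalfSpace k)
    (hC1 : HasC1Boundary U) (hf : ContDiffOn ℝ 1 f U) (hcont : ContinuousOn f (closure U))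
    (hy : y ∈ U)
    (hint : IntegrableOn (fun x => P k (vec (hypField y x) * diracHodge f x)) U) :
    ∫ x in frontier U, fieldL k (hypField y x) (f x) (outerNormal U x)
        ∂(Measure.euclideanHausdorffMeasure (k + 1)) =
      (∫ x in U, P k (vec (hypField y x) * diracHodge f x)) + (2 ^ k * sphereArea k) • P k (f y) := by
  obtain ⟨δ, hδ, hδU⟩ := Metric.nhds_basis_closedBall.mem_iff.1 (hU.mem_nhds hy)
  have hlim := (tendsto_setIntegral_puncture_smul (y := y) hint).sub
    (tendsto_integral_fieldL_cutoffGrad hU hupper hf.continuousOn hy)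
  rw [sub_neg_eq_add] at hlim
  -- The boundary integral does not depend on `r`, so it equals the limit of the punctured
  -- right-hand sides.
  refine tendsto_nhds_unique (tendsto_const_nhds.congr' ?_) hlim
  filter_upwards [Ioo_mem_nhdsGT hδ] with r hr
  have hrU := (Metric.closedBall_subset_closedBall hr.2.le).trans hδU
  rw [setIntegral_punctured hU hbdd hupper hfrontier hC1 hf hcont hy hr.1 hrU hint,
    setIntegral_fieldL_cutoffGrad hr.1 hrU]

end Representation

end

end UpperHalf

/-! ### The Borel–Pompeiu formula. -/

theorem theorem1 (k : ℕ) (U : Set (E k)) (hU : IsOpen U) (hbdd : Bornology.IsBounded U)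
    (hupper : U ⊆ upperHalfSpace k) (hfrontier : frontier U ⊆ upperHalfSpace k)
    (hC1 : HasC1Boundary U) (f : E k → Cl k) (hf : ContDiffOn ℝ 1 f U)
    (hcont : ContinuousOn f (closure U)) (hM : IntegrableOn (diracHodge f) U volume)
    (y : E k) (hy : y ∈ U) :
    IntegrableOn
        (fun x => kernelP x y * ((lastCoord x ^ k)⁻¹ • vec (outerNormal U x)) * f x)
        (frontier U) (Measure.euclideanHausdorffMeasure (k + 1)) ∧
      IntegrableOn (fun x => (lastCoord x ^ k)⁻¹ • (kernelP x y * diracHodge f x)) U volume ∧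
      P k (f y) = (1 / (2 ^ k * sphereArea k)) •
        P k ((∫ x in frontier U,
              kernelP x y * ((lastCoord x ^ k)⁻¹ • vec (outerNormal U x)) * f x
                ∂(Measure.euclideanHausdorffMeasure (k + 1))) -
            ∫ x in U, (lastCoord x ^ k)⁻¹ • (kernelP x y * diracHodge f x)) := by
  have hy' : 0 < lastCoord y := hupper hy
  have hfr : ∀ x ∈ frontier U, x ≠ y := fun x hx h => by
    rw [hU.frontier_eq] at hx
    exact hx.2 (h ▸ hy)
  have hbdry : ∀ x ∈ frontier U,
      kernelP x y * ((lastCoord x ^ k)⁻¹ • vec (outerNormal U x)) * f x =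
        vec (hypField y x) * vec (outerNormal U x) * f x := fun x hx => by
    have hx0 : 0 < lastCoord x := hfrontier hx
    rw [kernelP_eq hx0 hy' (hfr x hx), smul_mul_smul_comm, mul_inv_cancel₀ (by positivity),
      one_smul]
  have hvol : (fun x => (lastCoord x ^ k)⁻¹ • (kernelP x y * diracHodge f x))
      =ᵐ[volume.restrict U] fun x => vec (hypField y x) * diracHodge f x := by
    have hne : ∀ᵐ x ∂volume.restrict U, x ≠ y :=
      ae_restrict_of_ae (compl_mem_ae_iff.2 (measure_singleton y))
    filter_upwards [hne, ae_restrict_mem hU.measurableSet] with x hxy hx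
    have hx0 : 0 < lastCoord x := hupper hx
    rw [kernelP_eq hx0 hy' hxy, smul_mul_assoc, inv_smul_smul₀ (by positivity)]
  -- The field is taken without `P`, since the boundary integrand itself, not just its projection,
  -- must be integrable.
  have hF0 : ContinuousOn (fun x => ((mulL k).flip (f x)).comp
      ((mulL k (vecL k (hypField y x))).comp (vecL k))) (frontier U) := by
    have h1 : ContinuousOn (hypField y) (frontier U) := fun x hx =>
      (contDiffAt_hypField (sub_ne_zero.2 (hfr x hx))
        (sub_reflectLast_ne_zero (hfrontier hx) hy')).continuousAt.continuousWithinAt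
    have h2 := hcont.mono frontier_subset_closure
    fun_prop
  have hint1 : IntegrableOn (fun x => vec (hypField y x) * vec (outerNormal U x) * f x)
      (frontier U) (Measure.euclideanHausdorffMeasure (k + 1)) :=
    integrableOn_flux hU hbdd hC1 hF0
  have hint2 := integrableOn_vec_hypField_mul hU hupper
    (continuousOn_diracHodge hU hupper hf) hM hy
  refine ⟨hint1.congr_fun (fun x hx => (hbdry x hx).symm) isClosed_frontier.measurableSet,
    hint2.congr hvol.symm, ?_⟩
  have hkey := setIntegral_frontier_fieldL hU hbdd hupper hfrontier hC1 hf hcont hy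
    ((projL k).integrable_comp hint2)
  have e1 : ∫ x in frontier U, fieldL k (hypField y x) (f x) (outerNormal U x)
      ∂(Measure.euclideanHausdorffMeasure (k + 1)) = P k (∫ x in frontier U,
        vec (hypField y x) * vec (outerNormal U x) * f x
          ∂(Measure.euclideanHausdorffMeasure (k + 1))) :=
    (projL k).integral_comp_comm hint1
  have e2 : ∫ x in U, P k (vec (hypField y x) * diracHodge f x) =
      P k (∫ x in U, vec (hypField y x) * diracHodge f x) := (projL k).integral_comp_comm hint2
  rw [e1, e2] at hkey
  have hpos : (2 ^ k * sphereArea k) ≠ 0 := (mul_pos (by positivity) (sphereArea_pos k)).ne'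
  rw [setIntegral_congr_fun isClosed_frontier.measurableSet hbdry, integral_congr_ae hvol, map_sub,
    hkey, add_sub_cancel_left, one_div, inv_smul_smul₀ hpos]
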